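/- Let $\Gamma$ be a torsion-free abelian group and let $E=\bigoplus_{\gamma\in\Gamma}E_\gamma$ be a graded division ring (a nonzero $\Gamma$-graded ring in which every nonzero homogeneous element is invertible) that is finite-dimensional over its center $T$ (a graded subring of $E$). Put $T_0=T\cap E_0$, $\Gamma_E=\{\gamma: E_\gamma\neq 0\}$ and $\Gamma_T=\{\gamma: T\cap E_\gamma\ne 0\}$, which are subgroups of $\Gamma$, and let $n=\operatorname{ind}(E)$, i.e. $n^2=[E:T]$. For an Azumaya algebra $A$ over its center, let $A^{(1)}\subseteq A^*$ be the group of elements of reduced norm $1$ and $\mathrm{SK}_1(A)=A^{(1)}/[A^*,A^*]$; this applies to $A=E$ and to the division ring $A=E_0$. For a finite group $G$ and a multiplicatively written $G$-module $M$, let $N_G(a)=\prod_{g\in G}g(a)$, let $I_G(M)$ be the subgroup generated by all $a\,g(a)^{-1}$ ($a\in M$, $g\in G$), and let $\widehat H^{-1}(G,M)=\ker(N_G)/I_G(M)$. Write $\mu_k(T_0)$ for the group of $k$-th roots of unity in $T_0$. Then: (i) If $E$ is unramified, i.e. $\Gamma_E=\Gamma_T$, then $\mathrm{SK}_1(E)\cong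 \mathrm{SK}_1(E_0)$. (ii) If $E$ is totally ramified, i.e. $E_0=T_0$, then $\mu_e(T_0)\subseteq\mu_n(T_0)$ and $\mathrm{SK}_1(E)\cong\mu_n(T_0)/\mu_e(T_0)$, where $e$ is the exponent of $\Gamma_E/\Gamma_T$. (iii) If $E$ is semiramified, i.e. $E_0$ is a field and $[E_0:T_0]=|\Gamma_E:\Gamma_T|=\operatorname{ind}(E)$, then the group $G=\mathrm{Gal}(E_0/T_0)$ is finite abelian, conjugation by homogeneous units of $E$ induces an isomorphism $\Gamma_E/\Gamma_T\cong G$, and there is an exact sequence $$G\wedge G\ \longrightarrow\ \widehat H^{-1}(G,E_0^*)\ \longrightarrow\ \mathrm{SK}_1(E)\ \longrightarrow\ 1,$$ where the left map sends $\sigma\wedge\tau$ to the class of $xyx^{-1}y^{-1}$ for any $x,y\in E^*$ acting on $E_0$ by conjugation as $\sigma,\tau$ respectively, and the middle map is induced by the inclusion $E_0^*\subseteq E^*$. (iv) If $E$ has maximal graded subfields $L$ and $K$ (maximal among the commutative graded subrings of $E$ whose nonzero homogeneous elements are invertible in them) such that $L$ is unramified over $T$, i.e. $\Gamma_L=\Gamma_T$,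 and $K$ is totally ramified over $T$, i.e. $K_0=T_0$, then $E$ is semiramified and $\mathrm{SK}_1(E)\cong\widehat H^{-1}(\mathrm{Gal}(E_0/T_0),E_0^*)$. -/

import Mathlib

open scoped TensorProduct IsMulCommutative

namespace GrDiv

universe u v

section ReducedNorm

/-- `t` is the reduced norm of `a`, where `A` is an Azumaya algebra over its center `R`: for every
commutative faithfully flat `R`-algebra `S` splitting `A` (that is, `S ⊗ A ≅ Mₙ(S)`), the image
of `t` in `S` is the determinant of the matrix corresponding to `1 ⊗ a`.  (An Azumaya algebra of
constant rank has such splitting algebras, and by descent the determinant does not depend on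
`S` nor on the isomorphism and lies in `R`.) -/
def IsReducedNorm {A : Type u} [Ring A] (a : A) (t : Subring.center A) : Prop :=
  ∀ (S : Type u) [CommRing S] [Algebra (Subring.center A) S]
    [Module.FaithfullyFlat (Subring.center A) S] (n : ℕ)
    (φ : S ⊗[Subring.center A] A ≃ₐ[S] Matrix (Fin n) (Fin n) S),
    (φ (1 ⊗ₜ[Subring.center A] a)).det = algebraMap (Subring.center A) S t

/-- `A^(1)`, the group of elements of reduced norm `1`. -/
def reducedNormOne (A : Type u) [Ring A] : Subgroup Aˣ where
  carrier := {a | IsReducedNorm (a : A) 1}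
  one_mem' := by
    intro S _ _ _ n φ
    rw [Units.val_one, ← Algebra.TensorProduct.one_def, map_one, Matrix.det_one, map_one]
  mul_mem' := by
    intro a b ha hb S _ _ _ n φ
    have h : (1 : S) ⊗ₜ[Subring.center A] ((a * b : Aˣ) : A)
        = (1 ⊗ₜ[Subring.center A] (a : A)) * (1 ⊗ₜ[Subring.center A] (b : A)) := by
      rw [Algebra.TensorProduct.tmul_mul_tmul, one_mul, Units.val_mul]
    rw [h, map_mul, Matrix.det_mul, ha S n φ, hb S n φ, map_one, one_mul]
  inv_mem' := by
    intro a ha S _ _ _ n φ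
    have h : (1 : S ⊗[Subring.center A] A)
        = (1 ⊗ₜ[Subring.center A] (a : A)) * (1 ⊗ₜ[Subring.center A] ((a⁻¹ : Aˣ) : A)) := by
      rw [Algebra.TensorProduct.tmul_mul_tmul, one_mul, Units.mul_inv,
        Algebra.TensorProduct.one_def]
    have h2 := congrArg (fun x => (φ x).det) h
    simp only [map_one, map_mul, Matrix.det_one, Matrix.det_mul] at h2
    rw [ha S n φ, map_one, one_mul] at h2
    rw [← h2, map_one]

/-- The reduced Whitehead group `SK₁(A) = A^(1) / [A*, A*]`. -/
abbrev SK1 (A : Type u) [Ring A] : Type u :=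
  reducedNormOne A ⧸ (commutator Aˣ).subgroupOf (reducedNormOne A)

/-- The element `q` of `SK₁(A)` is the class of `a`. -/
def SK1.IsClassOf {A : Type u} [Ring A] (q : SK1 A) (a : A) : Prop :=
  ∃ b : reducedNormOne A, ((b : Aˣ) : A) = a ∧ (QuotientGroup.mk b : SK1 A) = q

end ReducedNorm

section Tate

variable (G : Type u) (A : Type v) [Group G] [Finite G] [CommGroup A] [MulDistribMulAction G A]

/-- The norm map `N_G : A → A`, `a ↦ ∏_{g ∈ G} g a`, for a (multiplicative) `G`-module `A`. -/
noncomputable def normMap : A →* A where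
  toFun a := ∏ᶠ g : G, g • a
  map_one' := by simp
  map_mul' a b := by
    simp only [smul_mul']
    exact finprod_mul_distrib (Set.toFinite _) (Set.toFinite _)

/-- `I_G(A)`, the subgroup of `A` generated by the elements `a / g a`. -/
def augmentationPart : Subgroup A :=
  Subgroup.closure {x | ∃ (a : A) (g : G), x = a / g • a}

/-- `Ĥ⁻¹(G, A) = ker N_G / I_G(A)`. -/
abbrev TateHMinusOne : Type v :=
  (normMap G A).ker ⧸ (augmentationPart G A).subgroupOf (normMap G A).ker

end Tate

section Graded

variable {Γ : Type v} [AddCommGroup Γ] [DecidableEq Γ] {E : Type u} [Ring E]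
  (𝒜 : Γ → AddSubgroup E) [GradedRing 𝒜]

/-- Every nonzero homogeneous element is invertible.  (The grade group is required to be
torsion-free separately.) -/
class IsGradedDivisionRing : Prop extends Nontrivial E where
  isUnit_of_mem : ∀ (γ : Γ) (a : E), a ∈ 𝒜 γ → a ≠ 0 → IsUnit a

/-- The grade set `Γ_S` of a subring `S` of `E`. -/
def gradeSet (S : Subring E) : Set Γ := {γ | ∃ a ∈ S, a ∈ 𝒜 γ ∧ a ≠ 0}

theorem exists_homogeneous_inverse [IsGradedDivisionRing 𝒜] {γ : Γ} {a : E} (ha : a ∈ 𝒜 γ)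
    (h0 : a ≠ 0) : ∃ b ∈ 𝒜 (-γ), a * b = 1 ∧ b * a = 1 := by
  obtain ⟨u, rfl⟩ := IsGradedDivisionRing.isUnit_of_mem γ a ha h0
  have h1 : (u : E) * (DirectSum.decompose 𝒜 ((u⁻¹ : Eˣ) : E) (-γ) : E) = 1 := by
    have h2 := DirectSum.coe_decompose_mul_add_of_left_mem 𝒜 (j := -γ) (b := ((u⁻¹ : Eˣ) : E)) ha
    rw [add_neg_cancel, Units.mul_inv,
      DirectSum.decompose_of_mem_same 𝒜 SetLike.GradedOne.one_mem] at h2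
    exact h2.symm
  have h3 : (DirectSum.decompose 𝒜 ((u⁻¹ : Eˣ) : E) (-γ) : E) = ((u⁻¹ : Eˣ) : E) :=
    by
    have h4 := congrArg (((u⁻¹ : Eˣ) : E) * ·) h1
    simpa using h4
  exact ⟨((u⁻¹ : Eˣ) : E), h3 ▸ (DirectSum.decompose 𝒜 ((u⁻¹ : Eˣ) : E) (-γ)).2, by simp, by simp⟩

/-- The grade group of a subring of a graded division ring that is closed under inverses. -/
def gradeGroupOf [IsGradedDivisionRing 𝒜] (S : Subring E)
    (hS : ∀ a b : E, a ∈ S → a * b = 1 → b * a = 1 → b ∈ S) : AddSubgroup Γ where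
  carrier := gradeSet 𝒜 S
  zero_mem' := ⟨1, S.one_mem, SetLike.GradedOne.one_mem,
    (haveI := IsGradedDivisionRing.toNontrivial 𝒜; one_ne_zero)⟩
  add_mem' := by
    rintro γ δ ⟨a, haS, ha, ha0⟩ ⟨b, hbS, hb, hb0⟩
    refine ⟨a * b, S.mul_mem haS hbS, SetLike.GradedMul.mul_mem ha hb, ?_⟩
    rwa [Ne, (IsGradedDivisionRing.isUnit_of_mem γ a ha ha0).mul_right_eq_zero]
  neg_mem' := by
    rintro γ ⟨a, haS, ha, ha0⟩
    obtain ⟨b, hb, hab, hba⟩ := exists_homogeneous_inverse 𝒜 ha ha0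
    exact ⟨b, hS a b haS hab hba, hb, by rintro rfl; exact ha0 (by simpa using (congrArg (a * ·) hab).symm)⟩

/-- `Γ_E`. -/
def gradeGroup [IsGradedDivisionRing 𝒜] : AddSubgroup Γ :=
  gradeGroupOf 𝒜 ⊤ fun _ _ _ _ _ => Subring.mem_top _

/-- `Γ_T`, where `T` is the center of `E`. -/
def centerGradeGroup [IsGradedDivisionRing 𝒜] : AddSubgroup Γ :=
  gradeGroupOf 𝒜 (Subring.center E) fun a b ha hab hba => by
    rw [Subring.mem_center_iff] at ha ⊢
    intro g
    calc g * b = b * a * (g * b) := by rw [hba, one_mul]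
      _ = b * (a * g) * b := by simp only [mul_assoc]
      _ = b * (g * a) * b := by rw [ha g]
      _ = b * g * (a * b) := by simp only [mul_assoc]
      _ = b * g := by rw [hab, mul_one]

/-- `Γ_E / Γ_T`. -/
abbrev GradeQuotient [IsGradedDivisionRing 𝒜] : Type v :=
  gradeGroup 𝒜 ⧸ (centerGradeGroup 𝒜).addSubgroupOf (gradeGroup 𝒜)

/-- The ring `E₀`. -/
abbrev ZeroPart : Subring E := SetLike.GradeZero.subring 𝒜

/-- The ring `T₀ = T ∩ E₀`, as a subring of `E₀`. -/
def CenterZero : Subring (ZeroPart 𝒜) := (Subring.center E).comap (ZeroPart 𝒜).subtype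

instance : CommRing (CenterZero 𝒜) :=
  { (inferInstance : Ring (CenterZero 𝒜)) with
    mul_comm := fun a b => Subtype.ext (Subtype.ext
      ((Subring.mem_center_iff.mp b.2 ((a : ZeroPart 𝒜) : E)))) }

instance : Algebra (CenterZero 𝒜) (ZeroPart 𝒜) where
  algebraMap := (CenterZero 𝒜).subtype
  commutes' a x := Subtype.ext (Subring.mem_center_iff.mp a.2 (x : E)).symm
  smul_def' _ _ := rfl

/-- The Galois group `Gal(E₀/T₀)`. -/
abbrev GalZero : Type u := ZeroPart 𝒜 ≃ₐ[CenterZero 𝒜] ZeroPart 𝒜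

/-- The index of `E`: the natural number `n` with `n² = [E : T]`, for `T` the center of `E`. -/
noncomputable def ind (E : Type u) [Ring E] : ℕ :=
  Nat.sqrt (Module.finrank (Subring.center E) E)

/-- `Γ_E = Γ_T`. -/
def IsUnramified [IsGradedDivisionRing 𝒜] : Prop := gradeGroup 𝒜 = centerGradeGroup 𝒜

/-- `E₀ = T₀`. -/
def IsTotallyRamified : Prop := CenterZero 𝒜 = ⊤

/-- `E₀` is a field and `[E₀ : T₀] = |Γ_E : Γ_T| = ind E`. -/
structure IsSemiramified [IsGradedDivisionRing 𝒜] : Prop where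
  isField : IsField (ZeroPart 𝒜)
  finrank_eq : Module.finrank (CenterZero 𝒜) (ZeroPart 𝒜) = ind E
  index_eq : (centerGradeGroup 𝒜).relIndex (gradeGroup 𝒜) = ind E

variable {𝒜} in
theorem IsSemiramified.isMulCommutative [IsGradedDivisionRing 𝒜] (h : IsSemiramified 𝒜) :
    IsMulCommutative (ZeroPart 𝒜)ˣ :=
  ⟨⟨fun a b => Units.ext (h.isField.mul_comm a b)⟩⟩

/-- `Ĥ⁻¹(Gal(E₀/T₀), E₀*)` for a semiramified `E`. -/
abbrev TateZero [IsGradedDivisionRing 𝒜] (h : IsSemiramified 𝒜) [Finite (GalZero 𝒜)] : Type u :=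
  haveI := h.isMulCommutative
  TateHMinusOne (GalZero 𝒜) (ZeroPart 𝒜)ˣ

/-- The element `q` of `Ĥ⁻¹(Gal(E₀/T₀), E₀*)` is the class of the element `a` of `E₀*`. -/
def TateZero.IsClassOf [IsGradedDivisionRing 𝒜] {h : IsSemiramified 𝒜} [Finite (GalZero 𝒜)]
    (q : TateZero 𝒜 h) (a : E) : Prop :=
  haveI := h.isMulCommutative
  ∃ c : (normMap (GalZero 𝒜) (ZeroPart 𝒜)ˣ).ker,
    (((c : (ZeroPart 𝒜)ˣ) : ZeroPart 𝒜) : E) = a ∧ (QuotientGroup.mk c : TateZero 𝒜 h) = q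

/-- `x ∈ E*` acts on `E₀` by conjugation as `σ`. -/
def ConjActsAs (x : Eˣ) (σ : GalZero 𝒜) : Prop :=
  ∀ a : ZeroPart 𝒜, ((σ a : ZeroPart 𝒜) : E) = (x : E) * (a : E) * ((x⁻¹ : Eˣ) : E)

/-- `L` is a graded subfield of `E`: a commutative graded subring in which every nonzero
homogeneous element is invertible. -/
structure IsGradedSubfield (L : Subring E) : Prop where
  homogeneous : ∀ a ∈ L, ∀ γ : Γ, (DirectSum.decompose 𝒜 a γ : E) ∈ L
  comm : ∀ a ∈ L, ∀ b ∈ L, a * b = b * a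
  inv : ∀ a ∈ L, ∀ γ : Γ, a ∈ 𝒜 γ → a ≠ 0 → ∃ b ∈ L, a * b = 1

end Graded

end GrDiv

/-!
Everything rests on one computation of the reduced norm.  A maximal graded subfield `L` of `E` is
its own centralizer, and `E` is free as an `L`-module, with a homogeneous basis.  By a graded
version of Jacobson's density theorem, `E ⊗[T] L` acts on `E` as the full ring of `L`-linear
endomorphisms (`exists_sandwich_separating`, `sandwich_injective`), so `L` is a faithfully flat
splitting algebra.  Determinants do not depend on the splitting, because automorphisms of matrix
algebras over commutative rings preserve determinants (`det_algEquiv_matrix`,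
`det_splitting_transfer`).  Hence the reduced norm of `a` is the determinant of right multiplication
by `a` on `E` over `L`, and `[E : T] = [E : L]²`, that is, `[E : L] = ind E`
(`IsSelfCentralizing.isReducedNorm_iff`, `IsSelfCentralizing.finrank_center`).

As `Γ` is torsion-free, units of `E` are homogeneous (`exists_degree`), and the degree of the
reduced norm of a unit is `ind E` times its degree.  So the elements of reduced norm `1` lie in `E₀`
(`IsSelfCentralizing.mem_zero_of_isReducedNorm_one`), and `SK₁(E)` becomes a subquotient of `E₀*`;
what remains is to describe the reduced norm on `E₀*` and the commutators of units in each case.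

* If `E` is unramified, `E = E₀ T`, the reduced norm on `E₀` is the one of `E₀`, and every
  commutator of units is a commutator of elements of `E₀*`.
* If `E` is totally ramified, the reduced norm on `E₀ = T₀` is the `n`-th power, and the commutators
  form the image of a bimultiplicative alternating pairing on `Γ_E / Γ_T` with values in `T₀*`.  So
  they form a subgroup `C` of `μ_e`.  As the pairing is nondegenerate, `e` divides `|C|`, while
  `|μ_e| ≤ e`; hence `C = μ_e`.
* If `E` is semiramified, conjugation identifies `Γ_E / Γ_T` with the Galois group `G` of `E₀ / T₀`
  by Artin's theorem, and the reduced norm on `E₀*` is `N_G`.  The commutators of `E` are generated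
  by `I_G(E₀*)` and the commutators of chosen units, one for each degree; modulo `I_G` these
  commutators depend only on the automorphisms, and give the map on `G ∧ G`.
* If moreover a maximal graded subfield `K` is totally ramified, the homogeneous elements of `K`
  induce all of `G`.  They commute, so the map on `G ∧ G` is trivial.
-/

namespace GrDiv

open scoped commutatorElement

universe u v

set_option linter.unusedSectionVars false

/-! ### Determinants and automorphisms of matrix algebras -/

/-- An automorphism of a matrix algebra over an arbitrary commutative ring preserves determinants.
With `f i j` the images of the matrix units, every vector `v` gives a matrix `g v` with columns
`f i 0 v` and `ψ x * g v = g v * x`; the determinants of these matrices generate the unit ideal,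
because modulo a maximal ideal some `f 0 0 v` does not vanish, and then `g v` is invertible. -/
theorem det_algEquiv_matrix {R : Type*} [CommRing R] {n : ℕ}
    (ψ : Matrix (Fin n) (Fin n) R ≃ₐ[R] Matrix (Fin n) (Fin n) R)
    (x : Matrix (Fin n) (Fin n) R) : (ψ x).det = x.det := by
  classical
  rcases Nat.eq_zero_or_pos n with rfl | hn
  · simp [Matrix.det_fin_zero]
  let o : Fin n := ⟨0, hn⟩
  let f : Fin n → Fin n → Matrix (Fin n) (Fin n) R := fun i j => ψ (Matrix.single i j 1)
  have hf : ∀ i j k l, f i j * f k l = if j = k then f i l else 0 := by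
    intro i j k l
    simp only [f, ← map_mul]
    split_ifs with h
    · subst h; simp
    · rw [Matrix.single_mul_single_of_ne (h := h), map_zero]
  let g : Fin n → Matrix (Fin n) (Fin n) R := fun v => Matrix.of fun r i => f i o r v
  have hfg : ∀ v k l, f k l * g v = g v * Matrix.single k l 1 := by
    intro v k l
    ext r i
    have h1 : (f k l * g v) r i = (f k l * f i o) r v := by
      simp [Matrix.mul_apply, g]
    rw [h1, hf]
    rcases eq_or_ne l i with rfl | h2
    · simp [g]
    · rw [if_neg h2, Matrix.mul_single_apply_of_ne (hbj := h2.symm)]; simp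
  have hψg : ∀ v, ψ x * g v = g v * x := by
    intro v
    have hx : x = ∑ i, ∑ j, x i j • Matrix.single i j (1 : R) := by
      conv_lhs => rw [Matrix.matrix_eq_sum_single x]
      simp [Matrix.smul_single]
    rw [hx]
    simp only [map_sum, map_smul, Finset.sum_mul, Finset.mul_sum, smul_mul_assoc, mul_smul_comm]
    exact Finset.sum_congr rfl fun i _ => Finset.sum_congr rfl fun j _ => by
      rw [← hfg v i j]
  have hdet : ∀ v, (g v).det * ((ψ x).det - x.det) = 0 := by
    intro v
    have := congrArg Matrix.det (hψg v)
    rw [Matrix.det_mul, Matrix.det_mul] at this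
    linear_combination this
  let I : Ideal R := Ideal.span (Set.range fun v => (g v).det)
  have hI : I = ⊤ := by
    by_contra hI
    obtain ⟨m, hm, hIm⟩ := Ideal.exists_le_maximal I hI
    let _ : Field (R ⧸ m) := Ideal.Quotient.field m
    let q := Ideal.Quotient.mk m
    let F : Fin n → Fin n → Matrix (Fin n) (Fin n) (R ⧸ m) := fun i j => (f i j).map q
    have hF : ∀ i j k l, F i j * F k l = if j = k then F i l else 0 := by
      intro i j k l
      simp only [F, ← Matrix.map_mul, hf]
      split_ifs <;> simp
    have hsum : ∑ i, F i i = 1 := by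
      have h1 : ∑ i, f i i = 1 := by
        simp only [f, ← map_sum]
        have : (∑ i, Matrix.single i i (1 : R)) = (1 : Matrix (Fin n) (Fin n) R) := by
          ext a b
          simp [Matrix.sum_apply, Matrix.single_apply, Matrix.one_apply, ite_and]
        rw [this, map_one]
      have h2 := congrArg (fun M => q.mapMatrix M) h1
      simpa [map_sum, F] using h2
    have h00 : F o o ≠ 0 := by
      intro h
      have : ∀ i, F i i = 0 := by
        intro i
        have h1 : F i i = F i o * F o o * F o i := by simp [hF]
        rw [h1, h]; simp
      rw [Finset.sum_congr rfl fun i _ => this i, Finset.sum_const_zero] at hsum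
      have := congrFun (congrFun hsum o) o
      simp at this
    obtain ⟨r, v, hrv⟩ : ∃ r v, F o o r v ≠ 0 := by
      by_contra! h
      exact h00 (Matrix.ext h)
    have hd : ((g v).map q).det ≠ 0 := by
      intro h
      obtain ⟨w, hw0, hw⟩ := Matrix.exists_mulVec_eq_zero_iff.mpr h
      apply hw0
      funext j
      -- apply `f 0 j` to a linear relation between the columns
      have h1 : (F o j * (g v).map q).mulVec w = 0 := by
        rw [← Matrix.mulVec_mulVec, hw, Matrix.mulVec_zero]
      have h2 := congrFun h1 r
      have h3 : ∀ i, (F o j * (g v).map q) r i = if j = i then F o o r v else 0 := by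
        intro i
        have : (F o j * (g v).map q) r i = (F o j * F i o) r v := by
          simp [Matrix.mul_apply, g, F]
        rw [this, hF]
        split_ifs <;> simp
      simp only [Matrix.mulVec, dotProduct, h3, ite_mul, zero_mul, Finset.sum_ite_eq,
        Finset.mem_univ, if_true, Pi.zero_apply] at h2
      simpa [hrv] using h2
    apply hd
    have : ((g v).map q).det = q (g v).det := (RingHom.map_det q (g v)).symm
    rw [this]
    exact Ideal.Quotient.eq_zero_iff_mem.mpr (hIm (Ideal.subset_span ⟨v, rfl⟩))
  have key : ∀ y ∈ I, y * ((ψ x).det - x.det) = 0 := by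
    intro y hy
    refine Submodule.span_induction ?_ ?_ ?_ ?_ hy
    · rintro _ ⟨v, rfl⟩; exact hdet v
    · simp
    · intro a b _ _ ha hb; rw [add_mul, ha, hb, add_zero]
    · intro a b _ hb; rw [smul_eq_mul, mul_assoc, hb, mul_zero]
  have := key 1 (hI ▸ Submodule.mem_top)
  rw [one_mul] at this
  exact sub_eq_zero.mp this

/-- Algebra isomorphisms between matrix algebras preserve determinants; the sizes agree unless the
base ring is trivial. -/
theorem det_algEquiv_matrix' {R : Type*} [CommRing R] {m n : ℕ}
    (ψ : Matrix (Fin m) (Fin m) R ≃ₐ[R] Matrix (Fin n) (Fin n) R)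
    (x : Matrix (Fin m) (Fin m) R) : (ψ x).det = x.det := by
  nontriviality R
  have h := ψ.toLinearEquiv.finrank_eq
  simp only [Module.finrank_matrix, Fintype.card_fin, Module.finrank_self, mul_one] at h
  obtain rfl : m = n := Nat.mul_self_inj.mp h
  exact det_algEquiv_matrix ψ x

/-! ### Comparison of splitting algebras -/

section Splitting

variable {R A : Type*} [CommRing R] [Ring A] [Algebra R A]

/-- The `W`-algebra homomorphism `W ⊗ A → Mₙ(W)` extending `ρ : A → Mₙ(W)`. -/
noncomputable def extendScalarsHom {W : Type*} [CommRing W] [Algebra R W] {n : Type*} [Fintype n]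
    [DecidableEq n] (ρ : A →ₐ[R] Matrix n n W) : W ⊗[R] A →ₐ[W] Matrix n n W :=
  Algebra.TensorProduct.lift (Algebra.ofId W (Matrix n n W)) ρ
    fun x _ => Algebra.commute_algebraMap_left x _

theorem extendScalarsHom_tmul {W : Type*} [CommRing W] [Algebra R W] {n : Type*} [Fintype n]
    [DecidableEq n] (ρ : A →ₐ[R] Matrix n n W) (w : W) (a : A) :
    extendScalarsHom ρ (w ⊗ₜ a) = w • ρ a := by
  rw [Algebra.smul_def]
  exact Algebra.TensorProduct.lift_tmul _ _ _ w a

/-- The homomorphism `A → Mₙ(W)` obtained from a splitting `S ⊗ A ≃ Mₙ(S)` and an `S`-algebra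
`W`. -/
noncomputable def splittingHom {S : Type*} [CommRing S] [Algebra R S] {n : ℕ}
    (φ : S ⊗[R] A ≃ₐ[S] Matrix (Fin n) (Fin n) S) (W : Type*) [CommRing W] [Algebra R W]
    [Algebra S W] [IsScalarTower R S W] : A →ₐ[R] Matrix (Fin n) (Fin n) W :=
  ((IsScalarTower.toAlgHom R S W).mapMatrix).comp
    ((φ.toAlgHom.restrictScalars R).comp Algebra.TensorProduct.includeRight)

theorem splittingHom_apply {S : Type*} [CommRing S] [Algebra R S] {n : ℕ}
    (φ : S ⊗[R] A ≃ₐ[S] Matrix (Fin n) (Fin n) S) (W : Type*) [CommRing W] [Algebra R W]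
    [Algebra S W] [IsScalarTower R S W] (a : A) :
    splittingHom φ W a = (φ (1 ⊗ₜ a)).map (algebraMap S W) := rfl

/-- A splitting over `S` gives a splitting over every `S`-algebra. -/
theorem bijective_lift_splittingHom {S : Type*} [CommRing S] [Algebra R S] {n : ℕ}
    (φ : S ⊗[R] A ≃ₐ[S] Matrix (Fin n) (Fin n) S) (W : Type*) [CommRing W] [Algebra R W]
    [Algebra S W] [IsScalarTower R S W] :
    Function.Bijective (extendScalarsHom (splittingHom φ W)) := by
  let e1 := (TensorProduct.AlgebraTensorModule.cancelBaseChange R S S W A).symm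
  let e2 := TensorProduct.AlgebraTensorModule.congr (LinearEquiv.refl S W) φ.toLinearEquiv
  let e3 := (matrixEquivTensor (Fin n) S W).symm
  have h : ∀ z, extendScalarsHom (splittingHom φ W) z = e3 (e2 (e1 z)) := by
    intro z
    induction z with
    | zero => simp
    | add x y hx hy => simp only [map_add, hx, hy]
    | tmul w a =>
      rw [extendScalarsHom_tmul]
      simp only [e1, TensorProduct.AlgebraTensorModule.cancelBaseChange_symm_tmul, e2,
        TensorProduct.AlgebraTensorModule.congr_tmul, e3, LinearEquiv.refl_apply,
        matrixEquivTensor_apply_symm]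
      rfl
  have : (fun z => extendScalarsHom (splittingHom φ W) z) = e3 ∘ e2 ∘ e1 := funext h
  change Function.Bijective (fun z => extendScalarsHom _ z)
  rw [this]
  exact e3.bijective.comp (e2.bijective.comp e1.bijective)

/-- Two splittings assign the same determinant to `a` if one of them is faithfully flat and the
value in one of them lies in the base ring. -/
theorem det_splitting_transfer {S S' : Type*} [CommRing S] [Algebra R S] [CommRing S']
    [Algebra R S'] [Module.FaithfullyFlat R S] {m n : ℕ}
    (φ : S ⊗[R] A ≃ₐ[S] Matrix (Fin m) (Fin m) S)
    (φ' : S' ⊗[R] A ≃ₐ[S'] Matrix (Fin n) (Fin n) S') (a : A) (t : R)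
    (h : (φ (1 ⊗ₜ a)).det = algebraMap R S t) : (φ' (1 ⊗ₜ a)).det = algebraMap R S' t := by
  let W := S ⊗[R] S'
  let _ : Algebra S' W := Algebra.TensorProduct.rightAlgebra
  let e := AlgEquiv.ofBijective _ (bijective_lift_splittingHom φ W)
  let e' := AlgEquiv.ofBijective _ (bijective_lift_splittingHom φ' W)
  have h1 := det_algEquiv_matrix' (e.symm.trans e') (e (1 ⊗ₜ a))
  have he : e (1 ⊗ₜ a) = (φ (1 ⊗ₜ a)).map (algebraMap S W) := by
    simp [e, extendScalarsHom_tmul, splittingHom_apply]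
  have he' : e' (1 ⊗ₜ a) = (φ' (1 ⊗ₜ a)).map (algebraMap S' W) := by
    simp [e', extendScalarsHom_tmul, splittingHom_apply]
  rw [AlgEquiv.trans_apply, AlgEquiv.symm_apply_apply, he, he'] at h1
  have h2 : ∀ M : Matrix (Fin m) (Fin m) S, (M.map (algebraMap S W)).det = algebraMap S W M.det :=
    fun M => (RingHom.map_det (algebraMap S W) M).symm
  have h3 : ∀ M : Matrix (Fin n) (Fin n) S',
      (M.map (algebraMap S' W)).det = algebraMap S' W M.det :=
    fun M => (RingHom.map_det (algebraMap S' W) M).symm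
  rw [h2, h3, h, ← IsScalarTower.algebraMap_apply, IsScalarTower.algebraMap_apply R S' W] at h1
  exact Module.FaithfullyFlat.tensorProduct_mk_injective (A := R) (B := S) S' h1

end Splitting

/-- One faithfully flat splitting algebra suffices to recognize the reduced norm. -/
theorem isReducedNorm_iff_det {A S : Type u} [Ring A] [CommRing S]
    [Algebra (Subring.center A) S] [Module.FaithfullyFlat (Subring.center A) S] {n : ℕ}
    (φ : S ⊗[Subring.center A] A ≃ₐ[S] Matrix (Fin n) (Fin n) S) (a : A)
    (t : Subring.center A) :
    IsReducedNorm a t ↔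
      (φ (1 ⊗ₜ[Subring.center A] a)).det = algebraMap (Subring.center A) S t :=
  ⟨fun h => h S n φ, fun h _ _ _ _ _ φ' => det_splitting_transfer φ φ' a t h⟩

/-! ### Homogeneous components -/

section Components

variable {Γ : Type*} [AddCommGroup Γ] [DecidableEq Γ] {E : Type*} [Ring E]
  (𝒜 : Γ → AddSubgroup E) [GradedRing 𝒜]

theorem proj_mem (γ : Γ) (x : E) : GradedRing.proj 𝒜 γ x ∈ 𝒜 γ :=
  (DirectSum.decompose 𝒜 x γ).2

variable {𝒜} in
theorem proj_of_mem {γ : Γ} {x : E} (hx : x ∈ 𝒜 γ) : GradedRing.proj 𝒜 γ x = x :=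
  DirectSum.decompose_of_mem_same 𝒜 hx

variable {𝒜} in
theorem proj_of_mem_ne {γ δ : Γ} {x : E} (hx : x ∈ 𝒜 γ) (h : γ ≠ δ) :
    GradedRing.proj 𝒜 δ x = 0 :=
  DirectSum.decompose_of_mem_ne 𝒜 hx h

variable {𝒜} in
theorem proj_mul_of_left_mem {γ : Γ} (δ : Γ) {a : E} (ha : a ∈ 𝒜 γ) (b : E) :
    GradedRing.proj 𝒜 δ (a * b) = a * GradedRing.proj 𝒜 (δ - γ) b := by
  have := DirectSum.coe_decompose_mul_add_of_left_mem 𝒜 (j := δ - γ) (b := b) ha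
  rw [add_sub_cancel] at this
  exact this

variable {𝒜} in
theorem proj_mul_of_right_mem {γ : Γ} (δ : Γ) (a : E) {b : E} (hb : b ∈ 𝒜 γ) :
    GradedRing.proj 𝒜 δ (a * b) = GradedRing.proj 𝒜 (δ - γ) a * b := by
  have := DirectSum.coe_decompose_mul_add_of_right_mem 𝒜 (i := δ - γ) (a := a) hb
  rw [sub_add_cancel] at this
  exact this

theorem exists_sum_proj (x : E) :
    ∃ s : Finset Γ, (∀ γ ∉ s, GradedRing.proj 𝒜 γ x = 0) ∧ ∑ γ ∈ s, GradedRing.proj 𝒜 γ x = x := by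
  classical
  refine ⟨(DirectSum.decompose 𝒜 x).support, fun γ hγ => ?_, DirectSum.sum_support_decompose 𝒜 x⟩
  rw [DFinsupp.notMem_support_iff] at hγ
  rw [GradedRing.proj_apply, hγ, ZeroMemClass.coe_zero]

theorem ext_proj {x y : E} (h : ∀ γ, GradedRing.proj 𝒜 γ x = GradedRing.proj 𝒜 γ y) : x = y :=
  (DirectSum.decompose 𝒜).injective (DFinsupp.ext fun γ => Subtype.ext (h γ))

variable {𝒜} in
theorem degree_unique {γ δ : Γ} {x : E} (hγ : x ∈ 𝒜 γ) (hδ : x ∈ 𝒜 δ) (hx : x ≠ 0) : γ = δ := by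
  by_contra h
  exact hx ((proj_of_mem hδ).symm.trans (proj_of_mem_ne hγ h))

variable {𝒜} in
theorem mul_mem_add {γ δ : Γ} {x y : E} (hx : x ∈ 𝒜 γ) (hy : y ∈ 𝒜 δ) : x * y ∈ 𝒜 (γ + δ) :=
  SetLike.GradedMul.mul_mem hx hy

/-- A set of elements is homogeneous if it contains the homogeneous components of its elements. -/
def IsHomogeneousSet (X : Set E) : Prop := ∀ a ∈ X, ∀ γ, GradedRing.proj 𝒜 γ a ∈ X

variable {𝒜} in
theorem commute_of_forall_proj {X : Set E} (hX : IsHomogeneousSet 𝒜 X) {x : E}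
    (h : ∀ y ∈ X, ∀ γ, y ∈ 𝒜 γ → y * x = x * y) : x ∈ Set.centralizer X := by
  intro y hy
  obtain ⟨s, -, hs⟩ := exists_sum_proj 𝒜 y
  rw [← hs, Finset.sum_mul, Finset.mul_sum]
  exact Finset.sum_congr rfl fun γ _ => h _ (hX y hy γ) γ (proj_mem 𝒜 γ y)

variable {𝒜} in
theorem IsHomogeneousSet.centralizer {X : Set E} (hX : IsHomogeneousSet 𝒜 X) :
    IsHomogeneousSet 𝒜 (Set.centralizer X) := by
  intro x hx γ
  refine commute_of_forall_proj hX fun y hy δ hyδ => ?_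
  have h := congrArg (GradedRing.proj 𝒜 (γ + δ)) (hx y hy)
  rwa [proj_mul_of_left_mem _ hyδ, proj_mul_of_right_mem _ _ hyδ, add_sub_cancel_right] at h

theorem isHomogeneousSet_univ : IsHomogeneousSet 𝒜 (Set.univ : Set E) := fun _ _ _ => trivial

end Components

theorem mem_centralizer_of_mul_eq_one {E : Type*} [Ring E] {X : Set E} {a b : E}
    (ha : a ∈ Set.centralizer X) (hab : a * b = 1) (hba : b * a = 1) :
    b ∈ Set.centralizer X := by
  intro y hy
  calc y * b = b * a * (y * b) := by rw [hba, one_mul]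
    _ = b * (a * y) * b := by simp only [mul_assoc]
    _ = b * y * (a * b) := by rw [← ha y hy]; simp only [mul_assoc]
    _ = b * y := by rw [hab, mul_one]

/-! ### Homogeneous bases -/

section Scalars

variable {Γ : Type*} [AddCommGroup Γ] [DecidableEq Γ] {E : Type*} [Ring E]
  (𝒜 : Γ → AddSubgroup E) [GradedRing 𝒜]

/-- The ring `R` of scalars acts on `E` by left multiplication through an injection onto a graded
subring in which the nonzero homogeneous elements are invertible. -/
structure IsGradedScalars (R : Type*) [Ring R] [Module R E] : Prop where
  exists_proj : ∀ (r : R) (γ : Γ), ∃ s : R, s • (1 : E) = GradedRing.proj 𝒜 γ (r • (1 : E))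
  exists_inv : ∀ (r : R) (γ : Γ), r • (1 : E) ∈ 𝒜 γ → r ≠ 0 →
    ∃ s : R, s • (1 : E) ∈ 𝒜 (-γ) ∧ s * r = 1
  faithful : ∀ r : R, r • (1 : E) = 0 → r = 0

variable {𝒜} {R : Type*} [Ring R] [Module R E] [IsScalarTower R E E]

theorem smul_one_mul_eq (r : R) (x : E) : r • (1 : E) * x = r • x := by
  rw [smul_mul_assoc, one_mul]

theorem smul_mem_add {γ δ : Γ} {r : R} {x : E} (hr : r • (1 : E) ∈ 𝒜 γ) (hx : x ∈ 𝒜 δ) :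
    r • x ∈ 𝒜 (γ + δ) := by
  rw [← smul_one_mul_eq]
  exact mul_mem_add hr hx

theorem proj_smul_of_mem {γ δ : Γ} (r : R) {x : E} (hx : x ∈ 𝒜 δ) :
    GradedRing.proj 𝒜 γ (r • x) = GradedRing.proj 𝒜 (γ - δ) (r • (1 : E)) * x := by
  rw [← smul_one_mul_eq, proj_mul_of_right_mem _ _ hx]

/-- A relation between homogeneous elements has homogeneous components, so it suffices to exclude
relations with homogeneous coefficients whose terms all have the same degree. -/
theorem IsGradedScalars.linearIndependent (hR : IsGradedScalars 𝒜 R) {ι : Type*} {b : ι → E}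
    {β : ι → Γ} (hb : ∀ i, b i ∈ 𝒜 (β i))
    (h : ∀ (s : Finset ι) (γ : Γ) (c : ι → R), (∀ i ∈ s, c i • (1 : E) ∈ 𝒜 (γ - β i)) →
      ∑ i ∈ s, c i • b i = 0 → ∀ i ∈ s, c i = 0) : LinearIndependent R b := by
  rw [linearIndependent_iff']
  intro s g hg i hi
  refine hR.faithful _ (ext_proj 𝒜 fun η => ?_)
  choose c hc using fun j => hR.exists_proj (g j) (η + β i - β j)
  have h1 : ∑ j ∈ s, c j • b j = 0 := by
    have := congrArg (GradedRing.proj 𝒜 (η + β i)) hg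
    rw [map_sum, map_zero] at this
    rw [← this]
    refine Finset.sum_congr rfl fun j _ => ?_
    rw [proj_smul_of_mem _ (hb j), ← hc, smul_one_mul_eq]
  have h2 := h s (η + β i) c (fun j _ => by rw [hc]; exact proj_mem 𝒜 _ _) h1 i hi
  have h3 := hc i
  rw [h2, zero_smul, add_sub_cancel_right] at h3
  rw [← h3, map_zero]

/-- Homogeneous elements lying in distinct cosets of the degrees of the scalars are linearly
independent. -/
theorem IsGradedScalars.linearIndependent_of_degree (hR : IsGradedScalars 𝒜 R) {ι : Type*}
    {b : ι → E} {β : ι → Γ} (hb : ∀ i, b i ∈ 𝒜 (β i)) (hu : ∀ i, IsUnit (b i))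
    (h : ∀ i j, i ≠ j → ∀ r : R, r • (1 : E) ∈ 𝒜 (β j - β i) → r = 0) :
    LinearIndependent R b := by
  classical
  refine hR.linearIndependent hb fun s γ c hc hsum i hi => ?_
  by_contra hci
  have h0 : ∀ j ∈ s, j ≠ i → c j = 0 := by
    intro j hj hji
    obtain ⟨t, ht, htc⟩ := hR.exists_inv (c i) _ (hc i hi) hci
    have h1 : (c j * t) • (1 : E) ∈ 𝒜 (β i - β j) := by
      rw [mul_smul]
      have := smul_mem_add (hc j hj) ht
      rwa [show γ - β j + -(γ - β i) = β i - β j by abel] at this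
    have h2 := h j i hji _ h1
    calc c j = c j * t * c i := by rw [mul_assoc, htc, mul_one]
      _ = 0 := by rw [h2, zero_mul]
  rw [Finset.sum_eq_single_of_mem i hi fun j hj hji => by rw [h0 j hj hji, zero_smul],
    ← smul_one_mul_eq, (hu i).mul_left_eq_zero] at hsum
  exact hci (hR.faithful _ hsum)

/-- Graded modules over graded division rings have homogeneous bases. -/
theorem IsGradedScalars.exists_homogeneous_basis (hR : IsGradedScalars 𝒜 R) (M : Submodule R E)
    (hM : IsHomogeneousSet 𝒜 (M : Set E)) :
    ∃ s : Set E, (∀ x ∈ s, ∃ γ, x ∈ 𝒜 γ) ∧ LinearIndepOn R id s ∧ Submodule.span R s = M := by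
  let X : Set E := {x | x ∈ M ∧ ∃ γ, x ∈ 𝒜 γ}
  obtain ⟨s, hs, hmax⟩ := exists_maximal_linearIndepOn R (fun x : X => (x : E))
  let t : Set E := (fun x : X => (x : E)) '' s
  have ht : t ⊆ X := by rintro _ ⟨x, -, rfl⟩; exact x.2
  have hle : Submodule.span R t ≤ M := Submodule.span_le.mpr fun x hx => (ht hx).1
  -- the span of homogeneous elements is homogeneous
  have hspan : IsHomogeneousSet 𝒜 (Submodule.span R t : Set E) := by
    intro x hx γ
    refine Submodule.span_induction (p := fun x _ => ∀ γ, GradedRing.proj 𝒜 γ x ∈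
      Submodule.span R t) ?_ ?_ ?_ ?_ hx γ
    · intro x hx γ
      obtain ⟨-, δ, hδ⟩ := ht hx
      by_cases h : δ = γ
      · subst h; rw [proj_of_mem hδ]; exact Submodule.subset_span hx
      · rw [proj_of_mem_ne hδ h]; exact Submodule.zero_mem _
    · intro γ; rw [map_zero]; exact Submodule.zero_mem _
    · intro x y _ _ hx hy γ; rw [map_add]; exact Submodule.add_mem _ (hx γ) (hy γ)
    · intro r x _ hx γ
      obtain ⟨S, -, hS⟩ := exists_sum_proj 𝒜 x
      rw [← hS, Finset.smul_sum, map_sum]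
      refine Submodule.sum_mem _ fun δ _ => ?_
      obtain ⟨c, hc⟩ := hR.exists_proj r (γ - δ)
      rw [proj_smul_of_mem _ (proj_mem 𝒜 δ x), ← hc, smul_one_mul_eq]
      exact Submodule.smul_mem _ _ (hx δ)
  refine ⟨t, fun x hx => (ht hx).2, ?_, le_antisymm hle ?_⟩
  · have := hs.id_image
    exact this
  · intro x hx
    obtain ⟨S, -, hS⟩ := exists_sum_proj 𝒜 x
    rw [← hS]
    refine Submodule.sum_mem _ fun δ _ => ?_
    set y := GradedRing.proj 𝒜 δ x with hy
    have hyX : y ∈ X := ⟨hM x hx δ, δ, proj_mem 𝒜 δ x⟩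
    by_cases hys : (⟨y, hyX⟩ : X) ∈ s
    · exact Submodule.subset_span ⟨_, hys, rfl⟩
    · obtain ⟨a, ha, hay⟩ := hmax ⟨y, hyX⟩ hys
      -- some homogeneous component of `a` is nonzero, hence invertible
      obtain ⟨η, hη⟩ : ∃ η, GradedRing.proj 𝒜 η (a • (1 : E)) ≠ 0 := by
        by_contra! h
        exact ha (hR.faithful a (ext_proj 𝒜 fun γ => by rw [h, map_zero]))
      obtain ⟨c, hc⟩ := hR.exists_proj a η
      have hcy : c • y ∈ Submodule.span R t := by
        have := hspan _ hay (η + δ)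
        rwa [proj_smul_of_mem _ (proj_mem 𝒜 δ x), add_sub_cancel_right, ← hc, ← hy,
          smul_one_mul_eq] at this
      have hc0 : c ≠ 0 := by rintro rfl; exact hη (by rw [← hc, zero_smul])
      obtain ⟨d, -, hd⟩ := hR.exists_inv c η (by rw [hc]; exact proj_mem 𝒜 _ _) hc0
      have := Submodule.smul_mem _ d hcy
      rwa [smul_smul, hd, one_smul] at this

/-- A linearly independent set of elements is a basis of its span. -/
theorem exists_basis_span {s : Set E} (hli : LinearIndepOn R id s) :
    ∃ b : Module.Basis s R (Submodule.span R s), ∀ x : s, (b x : E) = x := by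
  have hli' : LinearIndependent R (fun x : s => (x : E)) := hli.linearIndependent
  have hr : Set.range (fun x : s => (x : E)) = s := Subtype.range_val
  exact ⟨(Module.Basis.span hli').map (LinearEquiv.ofEq _ _ (by rw [hr])),
    fun x => by simp [Module.Basis.span_apply]⟩

theorem IsGradedScalars.free (hR : IsGradedScalars 𝒜 R) (M : Submodule R E)
    (hM : IsHomogeneousSet 𝒜 (M : Set E)) : Module.Free R M := by
  obtain ⟨s, -, hli, rfl⟩ := hR.exists_homogeneous_basis M hM
  obtain ⟨b, -⟩ := exists_basis_span hli
  exact Module.Free.of_basis b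

/-- A finite graded module inside `E` has a finite homogeneous basis. -/
theorem IsGradedScalars.exists_finite_homogeneous_basis [Nontrivial R]
    (hR : IsGradedScalars 𝒜 R) (M : Submodule R E) [Module.Finite R M]
    (hM : IsHomogeneousSet 𝒜 (M : Set E)) :
    ∃ (n : ℕ) (b : Module.Basis (Fin n) R M) (β : Fin n → Γ), ∀ i, (b i : E) ∈ 𝒜 (β i) := by
  obtain ⟨s, hs, hli, rfl⟩ := hR.exists_homogeneous_basis M hM
  obtain ⟨b0, hb0⟩ := exists_basis_span hli
  have : Finite s := Module.Finite.finite_basis b0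
  obtain ⟨n, ⟨e⟩⟩ := Finite.exists_equiv_fin s
  choose β hβ using fun x : s => hs x x.2
  refine ⟨n, b0.reindex e, fun i => β (e.symm i), fun i => ?_⟩
  rw [Module.Basis.reindex_apply, hb0]
  exact hβ _

/-- The coefficients of a homogeneous element with respect to linearly independent homogeneous
elements are homogeneous. -/
theorem IsGradedScalars.coeff_mem (hR : IsGradedScalars 𝒜 R) {ι : Type*} [Fintype ι]
    {v : ι → E} (hli : LinearIndependent R v) {β : ι → Γ} (hv : ∀ i, v i ∈ 𝒜 (β i)) {γ : Γ}
    {r : ι → R} (hx : ∑ i, r i • v i ∈ 𝒜 γ) (i : ι) : r i • (1 : E) ∈ 𝒜 (γ - β i) := by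
  choose c hc using fun j => hR.exists_proj (r j) (γ - β j)
  have h1 : ∑ j, c j • v j = ∑ j, r j • v j := by
    conv_rhs => rw [← proj_of_mem hx]
    rw [map_sum]
    exact Finset.sum_congr rfl fun j _ => by
      rw [proj_smul_of_mem _ (hv j), ← hc, smul_one_mul_eq]
  have h2 : ∑ j, (r j - c j) • v j = 0 := by
    simp only [sub_smul, Finset.sum_sub_distrib, h1, sub_self]
  have h3 := Fintype.linearIndependent_iff.mp hli _ h2 i
  rw [sub_eq_zero.mp h3, hc]
  exact proj_mem 𝒜 _ _

theorem IsGradedScalars.repr_mem (hR : IsGradedScalars 𝒜 R) {ι : Type*} [Fintype ι]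
    (b : Module.Basis ι R E) {β : ι → Γ} (hb : ∀ i, b i ∈ 𝒜 (β i)) {γ : Γ} {x : E}
    (hx : x ∈ 𝒜 γ) (i : ι) : b.repr x i • (1 : E) ∈ 𝒜 (γ - β i) :=
  hR.coeff_mem b.linearIndependent hb (by rwa [b.sum_repr]) i

end Scalars

/-! ### Units of graded division rings -/

theorem twoUniqueSums_of_isAddTorsionFree (Γ : Type*) [AddCommGroup Γ] [IsAddTorsionFree Γ] :
    TwoUniqueSums Γ :=
  TwoUniqueSums.of_injective_addHom (DivisibleHull.coeAddMonoidHom (M := Γ)).toAddHom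
    DivisibleHull.coe_injective inferInstance

section Units

variable {Γ : Type*} [AddCommGroup Γ] [DecidableEq Γ] {E : Type*} [Ring E]
  {𝒜 : Γ → AddSubgroup E} [GradedRing 𝒜] [IsGradedDivisionRing 𝒜]

theorem isUnit_of_mem {γ : Γ} {a : E} (ha : a ∈ 𝒜 γ) (h0 : a ≠ 0) : IsUnit a :=
  IsGradedDivisionRing.isUnit_of_mem γ a ha h0

/-- In a graded division ring with torsion-free grade group the units are homogeneous: the sets of
degrees occurring in `a` and in `a⁻¹` have two uniquely attained sums unless both are singletons. -/
theorem exists_degree [IsAddTorsionFree Γ] (x : Eˣ) : ∃ γ, (x : E) ∈ 𝒜 γ := by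
  classical
  have := twoUniqueSums_of_isAddTorsionFree Γ
  have : Nontrivial E := IsGradedDivisionRing.toNontrivial 𝒜
  obtain ⟨s, hs0, hs⟩ := exists_sum_proj 𝒜 (x : E)
  obtain ⟨t, ht0, ht⟩ := exists_sum_proj 𝒜 ((x⁻¹ : Eˣ) : E)
  set a := fun γ => GradedRing.proj 𝒜 γ (x : E) with ha
  set b := fun γ => GradedRing.proj 𝒜 γ ((x⁻¹ : Eˣ) : E) with hb
  let A := s.filter fun γ => a γ ≠ 0
  let B := t.filter fun γ => b γ ≠ 0
  have hA : ∑ γ ∈ A, a γ = x := by rw [← hs]; exact Finset.sum_filter_ne_zero s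
  have hB : ∑ γ ∈ B, b γ = ((x⁻¹ : Eˣ) : E) := by rw [← ht]; exact Finset.sum_filter_ne_zero t
  have hAB : (∑ γ ∈ A, a γ) * (∑ γ ∈ B, b γ) = 1 := by rw [hA, hB, Units.mul_inv]
  have hu : ∀ γ ∈ A, ∀ δ ∈ B, UniqueAdd A B γ δ → γ + δ = 0 := by
    intro γ hγ δ hδ huniq
    by_contra h
    have h1 := congrArg (GradedRing.proj 𝒜 (γ + δ)) hAB
    have h1' : GradedRing.proj 𝒜 (γ + δ) (1 : E) = 0 :=
      proj_of_mem_ne SetLike.GradedOne.one_mem (Ne.symm h)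
    rw [h1', Finset.sum_mul_sum, map_sum, Finset.sum_eq_single_of_mem γ hγ, map_sum,
      Finset.sum_eq_single_of_mem δ hδ,
      proj_of_mem (mul_mem_add (proj_mem 𝒜 _ _) (proj_mem 𝒜 _ _))] at h1
    · have hγ0 : a γ ≠ 0 := (Finset.mem_filter.mp hγ).2
      have hδ0 : b δ ≠ 0 := (Finset.mem_filter.mp hδ).2
      exact hδ0 (((isUnit_of_mem (proj_mem 𝒜 γ _) hγ0).mul_right_eq_zero).mp h1)
    · intro j hj hjδ
      refine proj_of_mem_ne (mul_mem_add (proj_mem 𝒜 γ _) (proj_mem 𝒜 j _)) fun h2 => hjδ ?_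
      exact (huniq hγ hj h2).2
    · intro i hi hiγ
      rw [map_sum]
      refine Finset.sum_eq_zero fun j hj => ?_
      refine proj_of_mem_ne (mul_mem_add (proj_mem 𝒜 i _) (proj_mem 𝒜 j _)) fun h2 => hiγ ?_
      exact (huniq hi hj h2).1
  have hBne : B.Nonempty := by
    rw [Finset.nonempty_iff_ne_empty]
    intro h
    rw [h, Finset.sum_empty, mul_zero] at hAB
    exact zero_ne_one hAB
  have hAne : A.Nonempty := by
    rw [Finset.nonempty_iff_ne_empty]
    intro h
    rw [h, Finset.sum_empty, zero_mul] at hAB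
    exact zero_ne_one hAB
  have hcard : A.card * B.card ≤ 1 := by
    by_contra! h
    obtain ⟨p, hp, q, hq, hpq, hup, huq⟩ := TwoUniqueSums.uniqueAdd_of_one_lt_card h
    rw [Finset.mem_product] at hp hq
    have h1 := hu _ hp.1 _ hp.2 hup
    have h2 := hu _ hq.1 _ hq.2 huq
    have h3 := hup hq.1 hq.2 (by rw [h1, h2])
    exact hpq (Prod.ext h3.1.symm h3.2.symm)
  have hA1 : A.card = 1 := by
    have h1 := hAne.card_pos
    have h2 := hBne.card_pos
    nlinarith
  obtain ⟨γ, hγ⟩ := Finset.card_eq_one.mp hA1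
  refine ⟨γ, ?_⟩
  rw [← hA, hγ, Finset.sum_singleton]
  exact proj_mem 𝒜 _ _

theorem inv_mem_neg {γ : Γ} {x : Eˣ} (hx : (x : E) ∈ 𝒜 γ) : ((x⁻¹ : Eˣ) : E) ∈ 𝒜 (-γ) := by
  have : Nontrivial E := IsGradedDivisionRing.toNontrivial 𝒜
  obtain ⟨b, hb, hxb, -⟩ := exists_homogeneous_inverse 𝒜 hx x.ne_zero
  rwa [Units.inv_eq_of_mul_eq_one_right hxb]

/-! ### Graded subfields that are their own centralizers -/

theorem isGradedScalars_of_centralizer {R : Type*} [Ring R] [Module R E] [IsScalarTower R E E]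
    {Y : Set E} (hY : IsHomogeneousSet 𝒜 Y)
    (h : Set.range (fun r : R => r • (1 : E)) = Set.centralizer Y)
    (hinj : ∀ r : R, r • (1 : E) = 0 → r = 0) : IsGradedScalars 𝒜 R where
  exists_proj r γ := by
    have h1 : r • (1 : E) ∈ Set.centralizer Y := h ▸ ⟨r, rfl⟩
    have h2 := hY.centralizer _ h1 γ
    rw [← h] at h2
    exact h2
  exists_inv r γ hr h0 := by
    obtain ⟨b, hb, hrb, hbr⟩ := exists_homogeneous_inverse 𝒜 hr (fun h1 => h0 (hinj r h1))
    have h1 : r • (1 : E) ∈ Set.centralizer Y := h ▸ ⟨r, rfl⟩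
    have h2 := mem_centralizer_of_mul_eq_one h1 hrb hbr
    rw [← h] at h2
    obtain ⟨s, rfl⟩ := h2
    refine ⟨s, hb, ?_⟩
    rw [← sub_eq_zero]
    apply hinj
    rw [sub_smul, mul_smul, ← smul_one_mul_eq s, hbr, one_smul, sub_self]
  faithful := hinj

theorem isGradedScalars_center : IsGradedScalars 𝒜 (Subring.center E) := by
  refine isGradedScalars_of_centralizer (Y := Set.univ) (isHomogeneousSet_univ 𝒜) ?_ ?_
  · rw [Set.centralizer_univ]
    ext x
    constructor
    · rintro ⟨r, rfl⟩
      have : r • (1 : E) = r := by rw [Subring.smul_def, smul_eq_mul, mul_one]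
      change r • (1 : E) ∈ Subring.center E
      rw [this]
      exact r.2
    · intro hx
      exact ⟨⟨x, hx⟩, by change x * 1 = x; rw [mul_one]⟩
  · intro r hr
    refine Subtype.ext ?_
    change (r : E) * 1 = 0 at hr
    rwa [mul_one] at hr

/-- `L` is a graded subring that is equal to its centralizer. -/
structure IsSelfCentralizing (𝒜 : Γ → AddSubgroup E) [GradedRing 𝒜]
    (L : Subalgebra (Subring.center E) E) : Prop where
  homogeneous : IsHomogeneousSet 𝒜 (L : Set E)
  centralizer : Set.centralizer (L : Set E) = L

namespace IsSelfCentralizing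

variable {L : Subalgebra (Subring.center E) E} (hL : IsSelfCentralizing 𝒜 L)
include hL

theorem mul_comm {a b : E} (ha : a ∈ L) (hb : b ∈ L) : a * b = b * a := by
  have : b ∈ Set.centralizer (L : Set E) := by rw [hL.centralizer]; exact hb
  exact this a ha

theorem isMulCommutative : IsMulCommutative L :=
  ⟨⟨fun a b => Subtype.ext (hL.mul_comm a.2 b.2)⟩⟩

theorem mem_of_commute {x : E} (h : ∀ y ∈ L, y * x = x * y) : x ∈ L := by
  have : x ∈ Set.centralizer (L : Set E) := h
  rwa [hL.centralizer] at this

theorem mem_of_mul_eq_one {a b : E} (ha : a ∈ L) (hab : a * b = 1) (hba : b * a = 1) : b ∈ L := by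
  have h1 : a ∈ Set.centralizer (L : Set E) := by rw [hL.centralizer]; exact ha
  have := mem_centralizer_of_mul_eq_one h1 hab hba
  rwa [hL.centralizer] at this

theorem isGradedScalars : IsGradedScalars 𝒜 L := by
  have h : ∀ r : L, r • (1 : E) = r := fun r => by rw [Subalgebra.smul_def, smul_eq_mul, mul_one]
  refine isGradedScalars_of_centralizer (Y := (L : Set E)) hL.homogeneous ?_ ?_
  · rw [hL.centralizer]
    simp only [h]
    exact Subtype.range_val
  · intro r hr
    exact Subtype.ext ((h r).symm.trans hr)

end IsSelfCentralizing

theorem centralizer_centralizer_commute {X : Set E} (h : X ⊆ Set.centralizer X) :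
    Set.centralizer (Set.centralizer X) ⊆
      Set.centralizer (Set.centralizer (Set.centralizer X)) := by
  rw [Set.centralizer_centralizer_centralizer]
  exact Set.centralizer_subset h

/-- Adjoining a homogeneous element to a homogeneous set of commuting elements. -/
theorem homogeneous_commuting_insert {X : Set E} (hX : IsHomogeneousSet 𝒜 X)
    (hc : X ⊆ Set.centralizer X) {y : E} {γ : Γ} (hy : y ∈ 𝒜 γ) (hyX : y ∈ Set.centralizer X) :
    IsHomogeneousSet 𝒜 (X ∪ {y, 0}) ∧ X ∪ {y, 0} ⊆ Set.centralizer (X ∪ {y, 0}) := by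
  constructor
  · rintro a (ha | rfl | ha) δ
    · exact Or.inl (hX a ha δ)
    · by_cases h : γ = δ
      · subst h; rw [proj_of_mem hy]; exact Or.inr (Or.inl rfl)
      · rw [proj_of_mem_ne hy h]; exact Or.inr (Or.inr rfl)
    · rw [Set.mem_singleton_iff] at ha
      rw [ha, map_zero]; exact Or.inr (Or.inr rfl)
  · rintro a (ha | rfl | rfl)
    · rintro b (hb | rfl | rfl)
      · exact hc ha b hb
      · exact (hyX a ha).symm
      · rw [zero_mul, mul_zero]
    · rintro b (hb | rfl | rfl)
      · exact hyX b hb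
      · rfl
      · rw [zero_mul, mul_zero]
    · intro b _
      rw [zero_mul, mul_zero]

variable (𝒜) in
/-- Zorn's lemma provides a maximal homogeneous set of commuting elements; it equals its double
centralizer, hence it is a subring, and it is its own centralizer. -/
theorem exists_isSelfCentralizing :
    ∃ L : Subalgebra (Subring.center E) E, IsSelfCentralizing 𝒜 L := by
  obtain ⟨X, hX⟩ := zorn_subset
    {X : Set E | IsHomogeneousSet 𝒜 X ∧ X ⊆ Set.centralizer X} (by
      intro c hc hchain
      refine ⟨⋃₀ c, ⟨?_, ?_⟩, fun s hs => Set.subset_sUnion_of_mem hs⟩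
      · rintro a ⟨s, hs, ha⟩ γ
        exact ⟨s, hs, (hc hs).1 a ha γ⟩
      · rintro a ⟨s, hs, ha⟩ b ⟨t, ht, hb⟩
        rcases hchain.total hs ht with h | h
        · exact (hc ht).2 (h ha) b hb
        · exact (hc hs).2 ha b (h hb))
  obtain ⟨⟨hXh, hXc⟩, hmax⟩ := hX
  have hcc : Set.centralizer (Set.centralizer X) ⊆ X :=
    hmax ⟨hXh.centralizer.centralizer, centralizer_centralizer_commute hXc⟩
      Set.subset_centralizer_centralizer
  have hXX : Set.centralizer X = X := by
    refine Set.Subset.antisymm (fun x hx => ?_) hXc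
    have h1 : ∀ γ, GradedRing.proj 𝒜 γ x ∈ X := by
      intro γ
      have h2 := homogeneous_commuting_insert hXh hXc (proj_mem 𝒜 γ x) (hXh.centralizer x hx γ)
      exact hmax h2 Set.subset_union_left (Or.inr (Or.inl rfl))
    refine hcc ?_
    obtain ⟨s, -, hs⟩ := exists_sum_proj 𝒜 x
    rw [← hs]
    exact Subring.sum_mem (Subring.centralizer (Set.centralizer X)) fun γ _ =>
      Set.subset_centralizer_centralizer (h1 γ)
  refine ⟨Subalgebra.centralizer _ X, ⟨?_, ?_⟩⟩
  · rw [Subalgebra.coe_centralizer]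
    exact hXh.centralizer
  · rw [Subalgebra.coe_centralizer, hXX, hXX]

/-- A maximal graded subfield is its own centralizer. -/
theorem exists_isSelfCentralizing_of_maximal {S : Subring E}
    (hS : Maximal (IsGradedSubfield 𝒜) S) :
    ∃ L : Subalgebra (Subring.center E) E, IsSelfCentralizing 𝒜 L ∧ (L : Set E) = S := by
  have hSh : IsHomogeneousSet 𝒜 (S : Set E) := hS.prop.homogeneous
  have hSc : (S : Set E) ⊆ Set.centralizer S := fun a ha b hb => hS.prop.comm b hb a ha
  have hSS : Set.centralizer (S : Set E) = S := by
    refine Set.Subset.antisymm (fun x hx => ?_) hSc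
    have h1 : ∀ γ, GradedRing.proj 𝒜 γ x ∈ S := by
      intro γ
      obtain ⟨h2, h3⟩ := homogeneous_commuting_insert hSh hSc (proj_mem 𝒜 γ x)
        (hSh.centralizer x hx γ)
      let P := Subring.centralizer (Set.centralizer ((S : Set E) ∪ {GradedRing.proj 𝒜 γ x, 0}))
      have hP : IsGradedSubfield 𝒜 P :=
        { homogeneous := h2.centralizer.centralizer
          comm := fun a ha b hb => (centralizer_centralizer_commute h3 ha b hb).symm
          inv := by
            intro a ha δ haδ ha0
            obtain ⟨b, -, hab, hba⟩ := exists_homogeneous_inverse 𝒜 haδ ha0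
            exact ⟨b, mem_centralizer_of_mul_eq_one ha hab hba, hab⟩ }
      have hSP : S ≤ P := fun a ha => Set.subset_centralizer_centralizer (Or.inl ha)
      exact hS.le_of_ge hP hSP (Set.subset_centralizer_centralizer (Or.inr (Or.inl rfl)))
    obtain ⟨s, -, hs⟩ := exists_sum_proj 𝒜 x
    rw [← hs]
    exact S.sum_mem fun γ _ => h1 γ
  refine ⟨Subalgebra.centralizer _ (S : Set E), ⟨?_, ?_⟩, ?_⟩
  · rw [Subalgebra.coe_centralizer]
    exact hSh.centralizer
  · rw [Subalgebra.coe_centralizer, hSS, hSS]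
  · rw [Subalgebra.coe_centralizer, hSS]

end Units

/-! ### Density and the matrix representation over a self-centralizing subfield -/

section Sandwich

variable {E : Type*} [Ring E] (D : Subalgebra (Subring.center E) E)

/-- The operators `x ↦ ∑ dᵢ x eᵢ` with `dᵢ ∈ D` and `eᵢ ∈ E`. -/
def sandwich : D ⊗[Subring.center E] E →ₗ[Subring.center E] E →ₗ[Subring.center E] E :=
  TensorProduct.lift (LinearMap.mk₂ (Subring.center E)
    (fun d e => (LinearMap.mulRight (Subring.center E) e).comp
      (LinearMap.mulLeft (Subring.center E) (d : E)))
    (fun d d' e => by ext x; simp [add_mul])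
    (fun t d e => by ext x; simp)
    (fun d e e' => by ext x; simp [mul_add])
    (fun t d e => by ext x; simp))

theorem sandwich_tmul (d : D) (e x : E) : sandwich D (d ⊗ₜ e) x = d * x * e := rfl

variable {D}

theorem id_mem_range_sandwich : LinearMap.id ∈ LinearMap.range (sandwich D) :=
  ⟨1 ⊗ₜ 1, by ext x; rw [sandwich_tmul]; simp⟩

theorem mulRight_comp_mem_range_sandwich {F : E →ₗ[Subring.center E] E}
    (hF : F ∈ LinearMap.range (sandwich D)) (e : E) :
    (LinearMap.mulRight (Subring.center E) e).comp F ∈ LinearMap.range (sandwich D) := by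
  obtain ⟨w, rfl⟩ := hF
  induction w with
  | zero => rw [map_zero, LinearMap.comp_zero]; exact Submodule.zero_mem _
  | add x y hx hy => rw [map_add, LinearMap.comp_add]; exact Submodule.add_mem _ hx hy
  | tmul d e' =>
    exact ⟨d ⊗ₜ (e' * e), by ext x; simp [sandwich_tmul, mul_assoc]⟩

theorem mulLeft_comp_mem_range_sandwich {F : E →ₗ[Subring.center E] E}
    (hF : F ∈ LinearMap.range (sandwich D)) {d : E} (hd : d ∈ D) :
    (LinearMap.mulLeft (Subring.center E) d).comp F ∈ LinearMap.range (sandwich D) := by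
  obtain ⟨w, rfl⟩ := hF
  induction w with
  | zero => rw [map_zero, LinearMap.comp_zero]; exact Submodule.zero_mem _
  | add x y hx hy => rw [map_add, LinearMap.comp_add]; exact Submodule.add_mem _ hx hy
  | tmul d' e' =>
    exact ⟨(⟨d, hd⟩ * d') ⊗ₜ e', by ext x; simp [sandwich_tmul, mul_assoc]⟩

end Sandwich

section Density

variable {Γ : Type*} [AddCommGroup Γ] [DecidableEq Γ] {E : Type*} [Ring E]
  {𝒜 : Γ → AddSubgroup E} [GradedRing 𝒜] [IsGradedDivisionRing 𝒜]
  {D : Subalgebra (Subring.center E) E}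
  {R : Type*} [Ring R] [Module R E] [IsScalarTower R E E]

/-- A graded form of the Jacobson density theorem.  If the scalars `R` exhaust the centralizer of
the graded subring `D`, then homogeneous `R`-independent elements `x j` can be separated by
homogeneous operators `y ↦ ∑ dᵢ y eᵢ`. -/
theorem exists_sandwich_separating (hD : IsHomogeneousSet 𝒜 (D : Set E))
    (hC : ∀ y ∈ Set.centralizer (D : Set E), ∃ r : R, r • (1 : E) = y)
    {ι : Type*} {x : ι → E} {β : ι → Γ} (hx : ∀ i, x i ∈ 𝒜 (β i))
    (hli : LinearIndependent R x) (s : Finset ι) :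
    ∀ i ∈ s, ∃ F ∈ LinearMap.range (sandwich D), (∀ γ, ∀ y ∈ 𝒜 γ, F y ∈ 𝒜 (γ - β i)) ∧
      F (x i) = 1 ∧ ∀ j ∈ s, j ≠ i → F (x j) = 0 := by
  classical
  have : Nontrivial E := IsGradedDivisionRing.toNontrivial 𝒜
  have : Nontrivial R := by
    refine ⟨⟨0, 1, fun h => ?_⟩⟩
    have h1 : (1 : R) • (1 : E) = 0 := by rw [← h, zero_smul]
    rw [one_smul] at h1
    exact one_ne_zero h1
  induction s using Finset.induction_on with
  | empty => simp
  | insert k s hk ih =>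
    obtain ⟨G, hGZ, hGdeg, hGk, hGs⟩ : ∃ G ∈ LinearMap.range (sandwich D),
        (∀ γ, ∀ y ∈ 𝒜 γ, G y ∈ 𝒜 (γ - β k)) ∧ G (x k) = 1 ∧ ∀ j ∈ s, G (x j) = 0 := by
      by_contra! hcon
      have hall : ∀ W ∈ LinearMap.range (sandwich D), ∀ δ : Γ,
          (∀ γ, ∀ y ∈ 𝒜 γ, W y ∈ 𝒜 (γ + δ)) → (∀ j ∈ s, W (x j) = 0) → W (x k) = 0 := by
        intro W hW δ hdeg hs
        by_contra h0
        obtain ⟨b, hb, hWb, -⟩ := exists_homogeneous_inverse 𝒜 (hdeg _ _ (hx k)) h0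
        obtain ⟨j, hj, hj0⟩ := hcon _ (mulRight_comp_mem_range_sandwich hW b)
          (fun γ y hy => by
            have := mul_mem_add (hdeg γ y hy) hb
            rwa [show γ + δ + -(β k + δ) = γ - β k by abel] at this) hWb
        apply hj0
        simp [hs j hj]
      choose! F hFZ hFdeg hF1 hF0 using ih
      -- on the operators of a fixed degree, `W (x k)` is determined by the `W (x i)`
      have hrel : ∀ W ∈ LinearMap.range (sandwich D), ∀ δ : Γ,
          (∀ γ, ∀ y ∈ 𝒜 γ, W y ∈ 𝒜 (γ + δ)) → W (x k) = ∑ i ∈ s, F i (x k) * W (x i) := by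
        intro W hW δ hdeg
        have h1 := hall (W - ∑ i ∈ s, (LinearMap.mulRight _ (W (x i))).comp (F i))
          (Submodule.sub_mem _ hW (Submodule.sum_mem _ fun i hi =>
            mulRight_comp_mem_range_sandwich (hFZ i hi) _)) δ ?_ ?_
        · simpa [LinearMap.sum_apply, sub_eq_zero] using h1
        · intro γ y hy
          rw [LinearMap.sub_apply, LinearMap.sum_apply]
          refine (𝒜 _).sub_mem (hdeg γ y hy) ((𝒜 _).sum_mem fun i hi => ?_)
          have := mul_mem_add (hFdeg i hi γ y hy) (hdeg _ _ (hx i))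
          rwa [show γ - β i + (β i + δ) = γ + δ by abel] at this
        · intro j hj
          rw [LinearMap.sub_apply, LinearMap.sum_apply, Finset.sum_eq_single_of_mem j hj]
          · simp [hF1 j hj]
          · intro i hi hij
            simp [hF0 i hi j hj hij.symm]
      have hcent : ∀ i ∈ s, ∃ r : R, r • (1 : E) = F i (x k) := by
        intro i hi
        refine hC _ (commute_of_forall_proj hD fun d hd α hα => ?_)
        have h1 := hrel _ (mulLeft_comp_mem_range_sandwich (hFZ i hi) hd) (α - β i)
          (fun γ y hy => by
            have := mul_mem_add hα (hFdeg i hi γ y hy)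
            rwa [show α + (γ - β i) = γ + (α - β i) by abel] at this)
        rw [Finset.sum_eq_single_of_mem i hi] at h1
        · simpa [hF1 i hi] using h1
        · intro j hj hji
          simp [hF0 i hi j hj hji]
      choose! r hr using hcent
      have h1 := hrel _ id_mem_range_sandwich 0 (fun γ y hy => by rwa [add_zero])
      have h2 : x k ∈ Submodule.span R (x '' (s : Set ι)) := by
        rw [LinearMap.id_apply] at h1
        rw [h1]
        refine Submodule.sum_mem _ fun i hi => ?_
        rw [← hr i hi, LinearMap.id_apply, smul_one_mul_eq]
        exact Submodule.smul_mem _ _ (Submodule.subset_span ⟨i, hi, rfl⟩)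
      exact hli.notMem_span_image (by simpa using hk) h2
    intro i hi
    rcases Finset.mem_insert.mp hi with rfl | his
    · refine ⟨G, hGZ, hGdeg, hGk, fun j hj hji => hGs j ?_⟩
      exact (Finset.mem_insert.mp hj).resolve_left hji
    · obtain ⟨F, hFZ, hFdeg, hF1, hF0⟩ := ih i his
      refine ⟨F - (LinearMap.mulRight _ (F (x k))).comp G, Submodule.sub_mem _ hFZ
        (mulRight_comp_mem_range_sandwich hGZ _), ?_, ?_, ?_⟩
      · intro γ y hy
        refine (𝒜 _).sub_mem (hFdeg γ y hy) ?_
        have := mul_mem_add (hGdeg γ y hy) (hFdeg _ _ (hx k))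
        rwa [show γ - β k + (β k - β i) = γ - β i by abel] at this
      · simp [hGs i his, hF1]
      · intro j hj hji
        rcases Finset.mem_insert.mp hj with rfl | hjs
        · simp [hGk]
        · simp [hGs j hjs, hF0 j hjs hji]

/-- A graded module structure on `E` by graded scalars has a finite homogeneous basis. -/
theorem IsGradedScalars.exists_homogeneous_basis_top [Nontrivial R] [Module.Finite R E]
    (hR : IsGradedScalars 𝒜 R) :
    ∃ (n : ℕ) (b : Module.Basis (Fin n) R E) (β : Fin n → Γ), ∀ i, b i ∈ 𝒜 (β i) := by
  obtain ⟨n, b, β, hb⟩ := hR.exists_finite_homogeneous_basis ⊤ (isHomogeneousSet_univ 𝒜)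
  exact ⟨n, b.map Submodule.topEquiv, β, hb⟩

end Density

section Azumaya

variable {Γ : Type*} [AddCommGroup Γ] [DecidableEq Γ] {E : Type*} [Ring E]
  (𝒜 : Γ → AddSubgroup E) [GradedRing 𝒜] [IsGradedDivisionRing 𝒜]
  [Module.Finite (Subring.center E) E]
include 𝒜

theorem nontrivial_center : Nontrivial (Subring.center E) := by
  have : Nontrivial E := IsGradedDivisionRing.toNontrivial 𝒜
  infer_instance

theorem free_center : Module.Free (Subring.center E) E := by
  obtain ⟨s, -, hli, hs⟩ := (isGradedScalars_center (𝒜 := 𝒜)).exists_homogeneous_basis ⊤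
    (isHomogeneousSet_univ 𝒜)
  obtain ⟨b, -⟩ := exists_basis_span hli
  exact Module.Free.of_basis (b.map (LinearEquiv.ofTop _ hs))

/-- The algebra `E` is Azumaya: `E ⊗ E` acts faithfully on `E` from both sides.  By density it maps
onto the endomorphism ring, which has the same rank. -/
theorem sandwich_top_injective :
    Function.Injective (sandwich (⊤ : Subalgebra (Subring.center E) E)) := by
  have := nontrivial_center 𝒜
  have := free_center 𝒜
  obtain ⟨n, b, β, hb⟩ := (isGradedScalars_center (𝒜 := 𝒜)).exists_homogeneous_basis_top
  have hsurj : Function.Surjective (sandwich (⊤ : Subalgebra (Subring.center E) E)) := by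
    have hsep := exists_sandwich_separating (𝒜 := 𝒜) (D := ⊤) (R := Subring.center E)
      (isHomogeneousSet_univ 𝒜) (fun y hy => ⟨⟨y, by
        rw [Algebra.coe_top, Set.centralizer_univ] at hy
        exact hy⟩, by rw [Subring.smul_def, smul_eq_mul, mul_one]⟩) hb b.linearIndependent
        Finset.univ
    choose! F hFZ _ hF1 hF0 using hsep
    intro f
    have h1 : f = ∑ i, (LinearMap.mulRight _ (f (b i))).comp (F i) := by
      refine b.ext fun j => ?_
      rw [LinearMap.sum_apply, Finset.sum_eq_single_of_mem j (Finset.mem_univ j)]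
      · simp [hF1 j (Finset.mem_univ j)]
      · intro i _ hij
        simp [hF0 i (Finset.mem_univ i) j (Finset.mem_univ j) hij.symm]
    rw [← LinearMap.mem_range, h1]
    exact Submodule.sum_mem _ fun i _ =>
      mulRight_comp_mem_range_sandwich (hFZ i (Finset.mem_univ i)) _
  let e0 : (⊤ : Subalgebra (Subring.center E) E) ≃ₗ[Subring.center E] E :=
    Subalgebra.topEquiv.toLinearEquiv
  have : Module.Free (Subring.center E) (⊤ : Subalgebra (Subring.center E) E) :=
    Module.Free.of_equiv e0.symm
  have : Module.Finite (Subring.center E) (⊤ : Subalgebra (Subring.center E) E) :=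
    Module.Finite.equiv e0.symm
  let e : (E →ₗ[Subring.center E] E) ≃ₗ[Subring.center E]
      (⊤ : Subalgebra (Subring.center E) E) ⊗[Subring.center E] E :=
    LinearEquiv.ofFinrankEq _ _ (by
      rw [Module.finrank_linearMap, Module.finrank_tensorProduct, e0.finrank_eq])
  have h := OrzechProperty.injective_of_surjective_endomorphism
    (e.toLinearMap.comp (sandwich ⊤)) (e.surjective.comp hsurj)
  exact Function.Injective.of_comp h

/-- By flatness of `E` over its center this follows from the case `D = E`. -/
theorem sandwich_injective (D : Subalgebra (Subring.center E) E) :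
    Function.Injective (sandwich D) := by
  have := free_center 𝒜
  let i : D →ₗ[Subring.center E] (⊤ : Subalgebra (Subring.center E) E) :=
    (Subalgebra.inclusion le_top).toLinearMap
  have hi : Function.Injective (i.rTensor E) :=
    Module.Flat.rTensor_preserves_injective_linearMap i (Subalgebra.inclusion_injective le_top)
  have h : sandwich D = (sandwich ⊤).comp (i.rTensor E) := by
    refine TensorProduct.ext' fun d e => ?_
    rfl
  rw [h]
  exact (sandwich_top_injective 𝒜).comp hi

end Azumaya

/-! ### Reduced norms and the index -/

section Representation

variable {E : Type*} [Ring E] {L : Subalgebra (Subring.center E) E} [IsMulCommutative L]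
  {ι : Type*} [Fintype ι] [DecidableEq ι] (b : Module.Basis ι L E)

/-- The matrix of right multiplication by `a` on the left `L`-module `E`, its rows being the
coordinates of `bᵢ a`; with this convention `a ↦ M(a)` preserves products. -/
noncomputable def rightMulMatrix : E →ₐ[Subring.center E] Matrix ι ι L where
  toFun a := Matrix.of fun i j => b.repr (b i * a) j
  map_one' := by
    ext i j
    simp [Matrix.one_apply, Finsupp.single_apply]
  map_mul' a c := by
    refine Matrix.ext fun i k => ?_
    rw [Matrix.mul_apply]
    simp only [Matrix.of_apply]
    have h : b i * (a * c) = ∑ j, b.repr (b i * a) j • (b j * c) := by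
      rw [← mul_assoc]
      conv_lhs => rw [← b.sum_repr (b i * a)]
      rw [Finset.sum_mul]
      exact Finset.sum_congr rfl fun j _ => smul_mul_assoc _ _ _
    rw [h, map_sum, Finsupp.finsetSum_apply]
    exact Finset.sum_congr rfl fun j _ => by rw [map_smul, Finsupp.smul_apply, smul_eq_mul]
  map_zero' := by ext i j; simp
  map_add' a c := by ext i j; simp [mul_add]
  commutes' t := by
    refine Matrix.ext fun i j => ?_
    have h : b i * algebraMap (Subring.center E) E t = algebraMap (Subring.center E) L t • b i := by
      rw [algebraMap_smul, Algebra.smul_def, Algebra.commutes]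
    rw [Matrix.of_apply, h, map_smul, Finsupp.smul_apply, b.repr_self, Matrix.algebraMap_eq_diagonal,
      Matrix.diagonal_apply, Finsupp.single_apply]
    split_ifs <;> simp

theorem rightMulMatrix_apply (a : E) (i j : ι) : rightMulMatrix b a i j = b.repr (b i * a) j := rfl

theorem sandwich_apply_basis (w : L ⊗[Subring.center E] E) (i : ι) :
    sandwich L w (b i) = ∑ j, extendScalarsHom (rightMulMatrix b) w i j • b j := by
  induction w with
  | zero => simp
  | add x y hx hy =>
    rw [map_add, LinearMap.add_apply, hx, hy, map_add, ← Finset.sum_add_distrib]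
    exact Finset.sum_congr rfl fun j _ => by rw [Matrix.add_apply, add_smul]
  | tmul l e =>
    rw [sandwich_tmul, extendScalarsHom_tmul, mul_assoc]
    conv_lhs => rw [← b.sum_repr (b i * e)]
    rw [← smul_eq_mul, ← Subalgebra.smul_def, Finset.smul_sum]
    exact Finset.sum_congr rfl fun j _ => by
      rw [smul_smul, Matrix.smul_apply, rightMulMatrix_apply, smul_eq_mul]

theorem sandwich_smul (w : L ⊗[Subring.center E] E) (l : L) (x : E) :
    sandwich L w (l • x) = l • sandwich L w x := by
  induction w with
  | zero => simp
  | add y z hy hz => simp only [map_add, LinearMap.add_apply, hy, hz, smul_add]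
  | tmul d e =>
    rw [sandwich_tmul, sandwich_tmul, Subalgebra.smul_def, Subalgebra.smul_def, smul_eq_mul,
      smul_eq_mul]
    have h : (d : E) * l = l * d := congrArg Subtype.val (_root_.mul_comm d l)
    simp only [← mul_assoc, h]

end Representation

section ReducedNorm

variable {Γ : Type*} [AddCommGroup Γ] [DecidableEq Γ] {E : Type u} [Ring E]
  {𝒜 : Γ → AddSubgroup E} [GradedRing 𝒜] [IsGradedDivisionRing 𝒜]
  [Module.Finite (Subring.center E) E] {L : Subalgebra (Subring.center E) E}
  [IsMulCommutative L] (hL : IsSelfCentralizing 𝒜 L)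
include hL

theorem IsSelfCentralizing.free : Module.Free (Subring.center E) L :=
  (isGradedScalars_center (𝒜 := 𝒜)).free (Subalgebra.toSubmodule L) hL.homogeneous

theorem IsSelfCentralizing.nontrivial : Nontrivial L := by
  have : Nontrivial E := IsGradedDivisionRing.toNontrivial 𝒜
  infer_instance

theorem IsSelfCentralizing.finite : Module.Finite L E :=
  Module.Finite.of_restrictScalars_finite (Subring.center E) L E

/-- A self-centralizing graded subfield splits `E`. -/
theorem IsSelfCentralizing.bijective_extendScalarsHom {ι : Type*} [Fintype ι] [DecidableEq ι]
    (b : Module.Basis ι L E) {β : ι → Γ} (hb : ∀ i, b i ∈ 𝒜 (β i)) :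
    Function.Bijective (extendScalarsHom (rightMulMatrix b)) := by
  constructor
  · rw [injective_iff_map_eq_zero]
    intro w hw
    apply sandwich_injective 𝒜 L
    rw [map_zero]
    ext x
    rw [← b.sum_repr x, map_sum, map_sum]
    refine Finset.sum_congr rfl fun i _ => ?_
    rw [sandwich_smul, sandwich_apply_basis, hw]
    simp
  · have hsep := exists_sandwich_separating (𝒜 := 𝒜) (D := L) (R := L) hL.homogeneous
      (fun y hy => ⟨⟨y, by rwa [hL.centralizer] at hy⟩, by
        rw [Subalgebra.smul_def, smul_eq_mul, mul_one]⟩) hb b.linearIndependent Finset.univ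
    choose! F hFZ _ hF1 hF0 using hsep
    intro M
    rw [Matrix.matrix_eq_sum_single M, ← AlgHom.mem_range]
    refine Subalgebra.sum_mem _ fun i _ => Subalgebra.sum_mem _ fun j _ => ?_
    obtain ⟨w, hw⟩ := mulRight_comp_mem_range_sandwich
      (mulLeft_comp_mem_range_sandwich (hFZ i (Finset.mem_univ i)) (M i j).2) (b j)
    refine ⟨w, Matrix.ext fun k l => ?_⟩
    have h1 := sandwich_apply_basis b w k
    rw [hw] at h1
    have h2 : extendScalarsHom (rightMulMatrix b) w k l = b.repr
        (∑ j, extendScalarsHom (rightMulMatrix b) w k j • b j) l := by rw [b.repr_sum_self]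
    change extendScalarsHom (rightMulMatrix b) w k l = _
    rw [h2, ← h1]
    by_cases hik : i = k
    · subst hik
      have h3 : ((M i j : L) : E) * b j = M i j • b j := rfl
      simp only [LinearMap.comp_apply, LinearMap.mulLeft_apply, LinearMap.mulRight_apply,
        hF1 i (Finset.mem_univ i), mul_one, h3, map_smul, Finsupp.smul_apply, b.repr_self]
      by_cases hjl : j = l
      · subst hjl; simp
      · simp [hjl]
    · simp [hF0 i (Finset.mem_univ i) k (Finset.mem_univ k) (Ne.symm hik), hik]

/-- The reduced norm of `a` is the determinant of right multiplication by `a` on `E` over a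
self-centralizing graded subfield. -/
theorem IsSelfCentralizing.isReducedNorm_iff {n : ℕ} (b : Module.Basis (Fin n) L E)
    {β : Fin n → Γ} (hb : ∀ i, b i ∈ 𝒜 (β i)) (a : E) (t : Subring.center E) :
    IsReducedNorm a t ↔ (rightMulMatrix b a).det = algebraMap (Subring.center E) L t := by
  have := hL.free
  have := hL.nontrivial
  have := nontrivial_center 𝒜
  rw [isReducedNorm_iff_det (AlgEquiv.ofBijective _ (hL.bijective_extendScalarsHom b hb)) a t,
    AlgEquiv.ofBijective_apply, extendScalarsHom_tmul, one_smul]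

theorem IsSelfCentralizing.finrank_eq {n : ℕ} (b : Module.Basis (Fin n) L E)
    {β : Fin n → Γ} (hb : ∀ i, b i ∈ 𝒜 (β i)) :
    Module.finrank (Subring.center E) E = n * n := by
  have := free_center 𝒜
  have := hL.nontrivial
  have := nontrivial_center 𝒜
  have h := (AlgEquiv.ofBijective _
    (hL.bijective_extendScalarsHom b hb)).toLinearEquiv.finrank_eq
  rwa [Module.finrank_baseChange, Module.finrank_matrix, Fintype.card_fin, Module.finrank_self,
    mul_one] at h

theorem IsSelfCentralizing.ind_eq {n : ℕ} (b : Module.Basis (Fin n) L E)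
    {β : Fin n → Γ} (hb : ∀ i, b i ∈ 𝒜 (β i)) : ind E = n := by
  rw [ind, hL.finrank_eq b hb, Nat.sqrt_eq]

theorem IsSelfCentralizing.exists_basis :
    ∃ (n : ℕ) (b : Module.Basis (Fin n) L E) (β : Fin n → Γ), ∀ i, b i ∈ 𝒜 (β i) := by
  have := hL.nontrivial
  have := hL.finite
  exact hL.isGradedScalars.exists_homogeneous_basis_top

theorem IsSelfCentralizing.pos_of_basis {n : ℕ} (b : Module.Basis (Fin n) L E) : 0 < n := by
  have : Nontrivial E := IsGradedDivisionRing.toNontrivial 𝒜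
  rcases Nat.eq_zero_or_pos n with rfl | hn
  · exact absurd b.repr.toEquiv.subsingleton (not_subsingleton E)
  · exact hn

theorem IsSelfCentralizing.finrank_center {n : ℕ} (b : Module.Basis (Fin n) L E)
    {β : Fin n → Γ} (hb : ∀ i, b i ∈ 𝒜 (β i)) : Module.finrank (Subring.center E) L = n := by
  have := hL.free
  have := hL.nontrivial
  have := nontrivial_center 𝒜
  have : Nontrivial E := IsGradedDivisionRing.toNontrivial 𝒜
  have := Module.Free.of_basis b
  have h := Module.finrank_mul_finrank (Subring.center E) L E
  rw [hL.finrank_eq b hb, Module.finrank_eq_card_basis b, Fintype.card_fin] at h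
  exact Nat.eq_of_mul_eq_mul_right (hL.pos_of_basis b) h

theorem IsSelfCentralizing.finite_center : Module.Finite (Subring.center E) L := by
  obtain ⟨n, b, β, hb⟩ := hL.exists_basis
  have := hL.free
  have := nontrivial_center 𝒜
  exact Module.finite_of_finrank_pos (by rw [hL.finrank_center b hb]; exact hL.pos_of_basis b)

/-- A self-centralizing graded subfield has a homogeneous basis over the center, with `ind E`
elements. -/
theorem IsSelfCentralizing.exists_center_basis : ∃ (v : Fin (ind E) → E) (β : Fin (ind E) → Γ),
    (∀ i, v i ∈ 𝒜 (β i)) ∧ LinearIndependent (Subring.center E) v ∧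
      Submodule.span (Subring.center E) (Set.range v) = Subalgebra.toSubmodule L := by
  have : Module.Finite (Subring.center E) (Subalgebra.toSubmodule L) := hL.finite_center
  have := nontrivial_center 𝒜
  obtain ⟨m, c, κ, hc⟩ := (isGradedScalars_center (𝒜 := 𝒜)).exists_finite_homogeneous_basis
    (Subalgebra.toSubmodule L) hL.homogeneous
  obtain ⟨n, b, β, hb⟩ := hL.exists_basis
  have hm : ind E = m := by
    rw [hL.ind_eq b hb, ← hL.finrank_center b hb]
    exact (Module.finrank_eq_card_basis c).trans (Fintype.card_fin m)
  subst hm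
  refine ⟨fun i => c i, κ, hc, ?_, ?_⟩
  · exact c.linearIndependent.map' (Subalgebra.toSubmodule L).subtype
      (Submodule.ker_subtype _)
  · have h := congrArg (Submodule.map (Subalgebra.toSubmodule L).subtype) c.span_eq
    rw [Submodule.map_span, Submodule.map_subtype_top, ← Set.range_comp] at h
    exact h

/-- The entries of the matrix of a homogeneous element are homogeneous, and so is its determinant;
hence elements of reduced norm `1` have degree `0`. -/
theorem IsSelfCentralizing.mem_zero_of_isReducedNorm_one [IsAddTorsionFree Γ] {γ : Γ} {a : E}
    (ha : a ∈ 𝒜 γ) (h : IsReducedNorm a 1) : a ∈ 𝒜 0 := by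
  classical
  obtain ⟨n, b, β, hb⟩ := hL.exists_basis
  have : Nontrivial E := IsGradedDivisionRing.toNontrivial 𝒜
  have hn : n ≠ 0 := (hL.pos_of_basis b).ne'
  rw [hL.isReducedNorm_iff b hb, map_one] at h
  have hdeg : ((rightMulMatrix b a).det : E) ∈ 𝒜 (n • γ) := by
    rw [Matrix.det_apply]
    have hprod : ∀ (s : Finset (Fin n)) (f : Fin n → L) (δ : Fin n → Γ),
        (∀ i ∈ s, ((f i : L) : E) ∈ 𝒜 (δ i)) → ((∏ i ∈ s, f i : L) : E) ∈ 𝒜 (∑ i ∈ s, δ i) := by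
      intro s f δ
      induction s using Finset.induction_on with
      | empty => intro _; simpa using (SetLike.GradedOne.one_mem : (1 : E) ∈ 𝒜 0)
      | insert k s hk ih =>
        intro hf
        rw [Finset.prod_insert hk, Finset.sum_insert hk, Subalgebra.coe_mul]
        exact mul_mem_add (hf k (Finset.mem_insert_self k s))
          (ih fun i hi => hf i (Finset.mem_insert_of_mem hi))
    rw [AddSubmonoidClass.coe_finsetSum]
    refine (𝒜 _).sum_mem fun σ _ => ?_
    have h1 : ((∏ i, rightMulMatrix b a (σ i) i : L) : E) ∈ 𝒜 (n • γ) := by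
      have := hprod Finset.univ (fun i => rightMulMatrix b a (σ i) i)
        (fun i => β (σ i) + γ - β i) (fun i _ => by
          have := hL.isGradedScalars.repr_mem b hb (mul_mem_add (hb (σ i)) ha) i
          rwa [Subalgebra.smul_def, smul_eq_mul, mul_one] at this)
      rwa [Finset.sum_sub_distrib, Finset.sum_add_distrib, Equiv.sum_comp σ β, add_sub_cancel_left,
        Finset.sum_const, Finset.card_univ, Fintype.card_fin] at this
    rcases Int.units_eq_one_or (Equiv.Perm.sign σ) with hs | hs <;> rw [hs]
    · rwa [one_smul]
    · rw [Units.neg_smul, one_smul]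
      exact (𝒜 _).neg_mem h1
  rw [h] at hdeg
  have h0 : n • γ = 0 := degree_unique hdeg SetLike.GradedOne.one_mem one_ne_zero
  have hγ : γ = 0 := (nsmul_eq_zero_iff_right hn).mp h0
  rwa [hγ] at ha

end ReducedNorm

/-! ### Degrees of units and the subgroup `E₀*` -/

section DegreeZero

variable {Γ : Type v} [AddCommGroup Γ] [DecidableEq Γ] {E : Type u} [Ring E]
  (𝒜 : Γ → AddSubgroup E) [GradedRing 𝒜] [IsGradedDivisionRing 𝒜]

/-- The inclusion `E₀* → E*`. -/
def zeroUnits : (ZeroPart 𝒜)ˣ →* Eˣ := Units.map (ZeroPart 𝒜).subtype.toMonoidHom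

theorem coe_zeroUnits (u : (ZeroPart 𝒜)ˣ) : (zeroUnits 𝒜 u : E) = (u : ZeroPart 𝒜) := rfl

theorem zeroUnits_injective : Function.Injective (zeroUnits 𝒜) :=
  Units.map_injective (ZeroPart 𝒜).subtype_injective

theorem isDomain_centerZero : IsDomain (CenterZero 𝒜) := by
  have : Nontrivial E := IsGradedDivisionRing.toNontrivial 𝒜
  have : NoZeroDivisors (CenterZero 𝒜) := by
    refine ⟨fun {a b} hab => ?_⟩
    by_contra! h
    have ha0 : ((a : ZeroPart 𝒜) : E) ≠ 0 := fun h0 => h.1 (Subtype.ext (Subtype.ext h0))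
    have h1 : ((a : ZeroPart 𝒜) : E) * ((b : ZeroPart 𝒜) : E) = 0 :=
      congrArg (fun z : CenterZero 𝒜 => ((z : ZeroPart 𝒜) : E)) hab
    rw [(isUnit_of_mem (a : ZeroPart 𝒜).2 ha0).mul_right_eq_zero] at h1
    exact h.2 (Subtype.ext (Subtype.ext h1))
  exact NoZeroDivisors.to_isDomain _

variable {𝒜}

theorem zeroUnits_mem (u : (ZeroPart 𝒜)ˣ) : (zeroUnits 𝒜 u : E) ∈ 𝒜 0 := (u : ZeroPart 𝒜).2

theorem exists_zeroUnits {x : Eˣ} (hx : (x : E) ∈ 𝒜 0) : ∃ u, zeroUnits 𝒜 u = x := by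
  have h := inv_mem_neg hx
  rw [neg_zero] at h
  exact ⟨⟨⟨x, hx⟩, ⟨((x⁻¹ : Eˣ) : E), h⟩, Subtype.ext x.mul_inv, Subtype.ext x.inv_mul⟩,
    Units.ext rfl⟩

theorem mem_gradeGroup_of_mem {γ : Γ} {a : E} (ha : a ∈ 𝒜 γ) (h0 : a ≠ 0) : γ ∈ gradeGroup 𝒜 :=
  ⟨a, Subring.mem_top a, ha, h0⟩

theorem exists_unit_of_mem_gradeGroup {γ : Γ} (h : γ ∈ gradeGroup 𝒜) :
    ∃ x : Eˣ, (x : E) ∈ 𝒜 γ := by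
  obtain ⟨a, -, ha, h0⟩ := h
  obtain ⟨u, rfl⟩ := isUnit_of_mem ha h0
  exact ⟨u, ha⟩

theorem unit_mem_gradeGroup {γ : Γ} {x : Eˣ} (hx : (x : E) ∈ 𝒜 γ) : γ ∈ gradeGroup 𝒜 := by
  have : Nontrivial E := IsGradedDivisionRing.toNontrivial 𝒜
  exact mem_gradeGroup_of_mem hx x.ne_zero

theorem exists_unit_of_mem_centerGradeGroup {γ : Γ} (h : γ ∈ centerGradeGroup 𝒜) :
    ∃ t : Eˣ, (t : E) ∈ 𝒜 γ ∧ ∀ y : E, y * t = t * y := by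
  obtain ⟨a, haT, ha, h0⟩ := h
  obtain ⟨u, rfl⟩ := isUnit_of_mem ha h0
  exact ⟨u, ha, fun y => Subring.mem_center_iff.mp haT y⟩

theorem unit_mem_centerGradeGroup {γ : Γ} {x : Eˣ} (hx : (x : E) ∈ 𝒜 γ)
    (hT : ∀ y : E, y * x = x * y) : γ ∈ centerGradeGroup 𝒜 := by
  have : Nontrivial E := IsGradedDivisionRing.toNontrivial 𝒜
  exact ⟨x, Subring.mem_center_iff.mpr hT, hx, x.ne_zero⟩

/-- A unit whose degree is the degree of a central element is the product of an element of `E₀*`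
and a central unit. -/
theorem exists_zeroUnits_mul_central {γ : Γ} {x : Eˣ} (hx : (x : E) ∈ 𝒜 γ)
    (hγ : γ ∈ centerGradeGroup 𝒜) :
    ∃ (u : (ZeroPart 𝒜)ˣ) (t : Eˣ), x = zeroUnits 𝒜 u * t ∧ (t : E) ∈ 𝒜 γ ∧
      ∀ y : E, y * t = t * y := by
  obtain ⟨t, ht, htc⟩ := exists_unit_of_mem_centerGradeGroup hγ
  have h : ((x * t⁻¹ : Eˣ) : E) ∈ 𝒜 0 := by
    have := mul_mem_add hx (inv_mem_neg ht)
    rwa [add_neg_cancel] at this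
  obtain ⟨u, hu⟩ := exists_zeroUnits h
  exact ⟨u, t, by rw [hu, inv_mul_cancel_right], ht, htc⟩

theorem exists_degree_mem [IsAddTorsionFree Γ] (x : Eˣ) : ∃ γ : gradeGroup 𝒜, (x : E) ∈ 𝒜 γ := by
  obtain ⟨γ, hγ⟩ := exists_degree (𝒜 := 𝒜) x
  exact ⟨⟨γ, unit_mem_gradeGroup hγ⟩, hγ⟩

theorem conj_mem_zero [IsAddTorsionFree Γ] (x : Eˣ) {a : E} (ha : a ∈ 𝒜 0) :
    (x : E) * a * ((x⁻¹ : Eˣ) : E) ∈ 𝒜 0 := by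
  obtain ⟨γ, hγ⟩ := exists_degree (𝒜 := 𝒜) x
  have := mul_mem_add (mul_mem_add hγ ha) (inv_mem_neg hγ)
  rwa [add_zero, add_neg_cancel] at this

theorem commutator_mem_zero [IsAddTorsionFree Γ] (x y : Eˣ) :
    ((x * y * x⁻¹ * y⁻¹ : Eˣ) : E) ∈ 𝒜 0 := by
  obtain ⟨γ, hγ⟩ := exists_degree (𝒜 := 𝒜) x
  obtain ⟨δ, hδ⟩ := exists_degree (𝒜 := 𝒜) y
  have := mul_mem_add (mul_mem_add (mul_mem_add hγ hδ) (inv_mem_neg hγ)) (inv_mem_neg hδ)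
  rwa [show γ + δ + -γ + -δ = 0 by abel] at this

end DegreeZero

/-! ### Commutators and subquotients -/

theorem commutatorElement_mul_central_left {G : Type*} [Group G] {x y t : G}
    (ht : ∀ z, z * t = t * z) : ⁅x * t, y⁆ = ⁅x, y⁆ := by
  rw [commutatorElement_def, commutatorElement_def, mul_inv_rev, mul_assoc x, ← ht y]
  group

theorem commutatorElement_mul_central_right {G : Type*} [Group G] {x y t : G}
    (ht : ∀ z, z * t = t * z) : ⁅x, y * t⁆ = ⁅x, y⁆ := by
  rw [← commutatorElement_inv, commutatorElement_mul_central_left ht, commutatorElement_inv]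

theorem commutator_le_reducedNormOne (A : Type u) [Ring A] :
    commutator Aˣ ≤ reducedNormOne A := by
  intro x hx S _ _ _ n φ
  let f : A →* S := Matrix.detMonoidHom.comp (φ.toAlgHom.toRingHom.toMonoidHom.comp
    (Algebra.TensorProduct.includeRight :
      A →ₐ[Subring.center A] S ⊗[Subring.center A] A).toRingHom.toMonoidHom)
  have h := Abelianization.commutator_subset_ker (Units.map f) hx
  have h2 := congrArg Units.val (MonoidHom.mem_ker.mp h)
  rw [map_one]
  exact h2

/-- An injective homomorphism identifies subquotients. -/
theorem nonempty_subquotient_mulEquiv {G H : Type*} [Group G] [Group H] (f : H →* G)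
    (hf : Function.Injective f) {P Q : Subgroup G} {A B : Subgroup H} [(Q.subgroupOf P).Normal]
    [(B.subgroupOf A).Normal] (hP : A.map f = P) (hQ : B.map f = Q) :
    Nonempty (P ⧸ Q.subgroupOf P ≃* A ⧸ B.subgroupOf A) := by
  subst hP hQ
  refine ⟨(QuotientGroup.congr _ _ (A.equivMapOfInjective f hf) ?_).symm⟩
  ext ⟨x, hx⟩
  simp only [Subgroup.mem_map, Subgroup.mem_subgroupOf]
  constructor
  · rintro ⟨y, hy, h⟩
    exact ⟨y, hy, congrArg Subtype.val h⟩
  · rintro ⟨y, hy, rfl⟩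
    obtain ⟨z, hz, hzy⟩ := hx
    obtain rfl := hf hzy
    exact ⟨⟨z, hz⟩, hy, rfl⟩

section Finite

variable {Γ : Type v} [AddCommGroup Γ] [DecidableEq Γ] {E : Type u} [Ring E]
  (𝒜 : Γ → AddSubgroup E) [GradedRing 𝒜] [IsGradedDivisionRing 𝒜]
  [Module.Finite (Subring.center E) E]

/-- Units of degrees in distinct cosets of `Γ_T` are linearly independent over `T`. -/
theorem finite_gradeQuotient : Finite (GradeQuotient 𝒜) := by
  have := nontrivial_center 𝒜
  choose x hx using fun q : GradeQuotient 𝒜 => exists_unit_of_mem_gradeGroup (𝒜 := 𝒜) q.out.2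
  have h := (isGradedScalars_center (𝒜 := 𝒜)).linearIndependent_of_degree
    (b := fun q => (x q : E)) hx (fun q => (x q).isUnit) (by
      intro i j hij r hr
      by_contra h0
      apply hij
      rw [← i.out_eq', ← j.out_eq']
      refine (QuotientAddGroup.eq).mpr ?_
      rw [AddSubgroup.mem_addSubgroupOf]
      rw [Subring.smul_def, smul_eq_mul, mul_one] at hr
      have : (j.out : Γ) - i.out ∈ centerGradeGroup 𝒜 :=
        ⟨r, r.2, hr, fun h => h0 (Subtype.ext h)⟩
      rw [sub_eq_neg_add] at this
      exact this)
  exact h.finite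

theorem exponent_gradeQuotient_ne_zero : AddMonoid.exponent (GradeQuotient 𝒜) ≠ 0 := by
  have := finite_gradeQuotient 𝒜
  exact AddMonoid.exponent_ne_zero_of_finite

end Finite

/-! ### Totally ramified graded division rings -/

section TotallyRamified

variable {Γ : Type v} [AddCommGroup Γ] [IsAddTorsionFree Γ] [DecidableEq Γ] {E : Type u} [Ring E]
  (𝒜 : Γ → AddSubgroup E) [GradedRing 𝒜] [IsGradedDivisionRing 𝒜]

/-- The inclusion `T₀* → E*`. -/
def centerZeroUnits : (CenterZero 𝒜)ˣ →* Eˣ :=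
  (zeroUnits 𝒜).comp (Units.map (CenterZero 𝒜).subtype.toMonoidHom)

theorem centerZeroUnits_injective : Function.Injective (centerZeroUnits 𝒜) :=
  (zeroUnits_injective 𝒜).comp (Units.map_injective (CenterZero 𝒜).subtype_injective)

variable {𝒜} (h : IsTotallyRamified 𝒜)
include h

theorem IsTotallyRamified.mem_center {a : E} (ha : a ∈ 𝒜 0) : a ∈ Subring.center E := by
  have : (⟨a, ha⟩ : ZeroPart 𝒜) ∈ CenterZero 𝒜 := by
    rw [show CenterZero 𝒜 = ⊤ from h]; trivial
  exact this

theorem IsTotallyRamified.exists_centerZeroUnits {x : Eˣ} (hx : (x : E) ∈ 𝒜 0) :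
    ∃ t, centerZeroUnits 𝒜 t = x := by
  have hx' := inv_mem_neg hx
  rw [neg_zero] at hx'
  exact ⟨⟨⟨⟨x, hx⟩, h.mem_center hx⟩, ⟨⟨((x⁻¹ : Eˣ) : E), hx'⟩, h.mem_center hx'⟩,
    Subtype.ext (Subtype.ext x.mul_inv), Subtype.ext (Subtype.ext x.inv_mul)⟩, Units.ext rfl⟩

theorem IsTotallyRamified.commutator_central (x y z : Eˣ) :
    z * ⁅x, y⁆ = ⁅x, y⁆ * z := by
  refine Units.ext ?_
  exact Subring.mem_center_iff.mp (h.mem_center (commutator_mem_zero x y)) z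

theorem IsTotallyRamified.commutator_pow (x y : Eˣ) (k : ℕ) : ⁅x ^ k, y⁆ = ⁅x, y⁆ ^ k := by
  induction k with
  | zero => simp
  | succ k ih =>
    have h1 : ⁅x ^ (k + 1), y⁆ = x ^ k * ⁅x, y⁆ * (x ^ k)⁻¹ * ⁅x ^ k, y⁆ := by
      simp only [commutatorElement_def, pow_succ]; group
    rw [h1, h.commutator_central x y (x ^ k), mul_inv_cancel_right, ih, pow_succ']

/-- The commutator subgroup of a totally ramified `E` consists of the `e`-th roots of unity.  If it
has order `k`, then all `k`-th powers of units are central, so that the exponent `e` divides `k`,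
whereas there are at most `e` roots of unity of exponent `e`. -/
theorem IsTotallyRamified.map_rootsOfUnity_exponent [Module.Finite (Subring.center E) E] :
    (rootsOfUnity (AddMonoid.exponent (GradeQuotient 𝒜)) (CenterZero 𝒜)).map (centerZeroUnits 𝒜)
      = commutator Eˣ := by
  have := isDomain_centerZero 𝒜
  set e := AddMonoid.exponent (GradeQuotient 𝒜) with he
  have he0 : NeZero e := ⟨exponent_gradeQuotient_ne_zero 𝒜⟩
  let C := (commutator Eˣ).comap (centerZeroUnits 𝒜)
  have hmap : C.map (centerZeroUnits 𝒜) = commutator Eˣ := by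
    rw [Subgroup.map_comap_eq, inf_eq_right, commutator_def, Subgroup.commutator_le]
    intro x _ y _
    exact h.exists_centerZeroUnits (commutator_mem_zero x y)
  have hpow : ∀ (x y : Eˣ), ⁅x, y⁆ ^ e = 1 := by
    intro x y
    obtain ⟨γ, hγ⟩ := exists_degree_mem (𝒜 := 𝒜) x
    have h1 : e • (γ : Γ) ∈ centerGradeGroup 𝒜 := by
      have h2 : e • (γ : GradeQuotient 𝒜) = 0 := AddMonoid.exponent_nsmul_eq_zero _
      rw [← QuotientAddGroup.mk_nsmul, QuotientAddGroup.eq_zero_iff,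
        AddSubgroup.mem_addSubgroupOf] at h2
      exact h2
    have hxe : ((x ^ e : Eˣ) : E) ∈ 𝒜 (e • (γ : Γ)) := by
      rw [Units.val_pow_eq_pow_val]; exact SetLike.pow_mem_graded e hγ
    obtain ⟨u, t, hut, -, ht⟩ := exists_zeroUnits_mul_central hxe h1
    rw [← h.commutator_pow, commutatorElement_eq_one_iff_mul_comm, hut]
    refine Units.ext ?_
    have hu := Subring.mem_center_iff.mp (h.mem_center (zeroUnits_mem u)) (y : E)
    push_cast
    rw [mul_assoc, ← ht, ← mul_assoc, ← hu, mul_assoc]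
  have hC : C ≤ rootsOfUnity e (CenterZero 𝒜) := by
    have h1 : commutator Eˣ ≤ (rootsOfUnity e (CenterZero 𝒜)).map (centerZeroUnits 𝒜) := by
      rw [commutator_def, Subgroup.commutator_le]
      intro x _ y _
      obtain ⟨t, ht⟩ := h.exists_centerZeroUnits (commutator_mem_zero x y)
      refine ⟨t, ?_, ht⟩
      rw [SetLike.mem_coe, mem_rootsOfUnity]
      apply centerZeroUnits_injective 𝒜
      rw [map_pow, map_one, ht]
      exact hpow x y
    intro c hc
    obtain ⟨d, hd, hdc⟩ := h1 (show centerZeroUnits 𝒜 c ∈ _ from hc)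
    rwa [← centerZeroUnits_injective 𝒜 hdc]
  have hfin : Finite (rootsOfUnity e (CenterZero 𝒜)) := inferInstance
  have hdvd : e ∣ Nat.card C := by
    rw [he]
    refine AddMonoid.exponent_dvd_of_forall_nsmul_eq_zero fun q => ?_
    obtain ⟨γ, rfl⟩ := QuotientAddGroup.mk_surjective q
    obtain ⟨x, hx⟩ := exists_unit_of_mem_gradeGroup γ.2
    rw [← QuotientAddGroup.mk_nsmul, QuotientAddGroup.eq_zero_iff, AddSubgroup.mem_addSubgroupOf]
    have hxk : ((x ^ Nat.card C : Eˣ) : E) ∈ 𝒜 (Nat.card C • (γ : Γ)) := by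
      rw [Units.val_pow_eq_pow_val]; exact SetLike.pow_mem_graded _ hx
    have hcomm : ∀ y : Eˣ, x ^ Nat.card C * y = y * x ^ Nat.card C := by
      intro y
      rw [← commutatorElement_eq_one_iff_mul_comm, h.commutator_pow]
      obtain ⟨c, hc, hcx⟩ : ⁅x, y⁆ ∈ C.map (centerZeroUnits 𝒜) := by
        rw [hmap]
        exact Subgroup.commutator_mem_commutator trivial trivial
      have := congrArg Subtype.val (pow_card_eq_one' (x := (⟨c, hc⟩ : C)))
      rw [← hcx, ← map_pow]
      rw [show c ^ Nat.card C = 1 from this, map_one]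
    refine unit_mem_centerGradeGroup hxk fun y => ?_
    obtain ⟨s, -, hs⟩ := exists_sum_proj 𝒜 y
    rw [← hs, Finset.sum_mul, Finset.mul_sum]
    refine Finset.sum_congr rfl fun δ _ => ?_
    by_cases h0 : GradedRing.proj 𝒜 δ y = 0
    · rw [h0, zero_mul, mul_zero]
    · obtain ⟨v, hv⟩ := isUnit_of_mem (proj_mem 𝒜 δ y) h0
      rw [← hv]
      exact (congrArg Units.val (hcomm v)).symm
  have hCfin : Finite C := Finite.of_injective _ (Subgroup.inclusion_injective hC)
  have hle : Nat.card (rootsOfUnity e (CenterZero 𝒜)) ≤ Nat.card C := by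
    have h1 : Nat.card (rootsOfUnity e (CenterZero 𝒜)) ≤ e := card_rootsOfUnity _ _
    exact h1.trans (Nat.le_of_dvd Nat.card_pos hdvd)
  rw [← Subgroup.eq_of_le_of_card_ge hC hle, hmap]

/-- The reduced norm of an element of `E₀ = T₀` is its `n`-th power, and all elements of reduced norm
`1` have degree `0`. -/
theorem IsTotallyRamified.map_rootsOfUnity_ind [Module.Finite (Subring.center E) E] :
    (rootsOfUnity (ind E) (CenterZero 𝒜)).map (centerZeroUnits 𝒜) = reducedNormOne E := by
  obtain ⟨L, hL⟩ := exists_isSelfCentralizing 𝒜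
  have := hL.isMulCommutative
  have := hL.nontrivial
  obtain ⟨n, b, β, hb⟩ := hL.exists_basis
  have hnrd : ∀ t : (CenterZero 𝒜)ˣ,
      IsReducedNorm (centerZeroUnits 𝒜 t : E) 1 ↔ t ∈ rootsOfUnity (ind E) (CenterZero 𝒜) := by
    intro t
    let t' : Subring.center E := ⟨centerZeroUnits 𝒜 t, t.1.2⟩
    have h1 : (centerZeroUnits 𝒜 t : E) = algebraMap (Subring.center E) E t' := rfl
    rw [hL.isReducedNorm_iff b hb, h1, AlgHom.commutes, Matrix.algebraMap_eq_diagonal,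
      Matrix.det_diagonal, hL.ind_eq b hb, mem_rootsOfUnity, map_one]
    simp only [Pi.algebraMap_apply, Finset.prod_const, Finset.card_univ, Fintype.card_fin]
    constructor
    · intro h2
      refine Units.ext (Subtype.ext (Subtype.ext ?_))
      exact congrArg (fun z : L => (z : E)) h2
    · intro h2
      refine Subtype.ext ?_
      exact congrArg (fun z : (CenterZero 𝒜)ˣ => (((z : CenterZero 𝒜) : ZeroPart 𝒜) : E)) h2
  ext x
  constructor
  · rintro ⟨t, ht, rfl⟩
    exact (hnrd t).mpr ht
  · intro hx
    obtain ⟨γ, hγ⟩ := exists_degree (𝒜 := 𝒜) x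
    obtain ⟨t, rfl⟩ := h.exists_centerZeroUnits (hL.mem_zero_of_isReducedNorm_one hγ hx)
    exact ⟨t, (hnrd t).mp hx, rfl⟩

theorem IsTotallyRamified.sk1_mulEquiv [Module.Finite (Subring.center E) E] :
    rootsOfUnity (AddMonoid.exponent (GradeQuotient 𝒜)) (CenterZero 𝒜) ≤
        rootsOfUnity (ind E) (CenterZero 𝒜) ∧
      Nonempty (SK1 E ≃* rootsOfUnity (ind E) (CenterZero 𝒜) ⧸
        (rootsOfUnity (AddMonoid.exponent (GradeQuotient 𝒜)) (CenterZero 𝒜)).subgroupOf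
          (rootsOfUnity (ind E) (CenterZero 𝒜))) := by
  refine ⟨?_, nonempty_subquotient_mulEquiv (centerZeroUnits 𝒜) (centerZeroUnits_injective 𝒜)
    h.map_rootsOfUnity_ind h.map_rootsOfUnity_exponent⟩
  have := commutator_le_reducedNormOne E
  rwa [← h.map_rootsOfUnity_ind, ← h.map_rootsOfUnity_exponent,
    Subgroup.map_le_map_iff_of_injective (centerZeroUnits_injective 𝒜)] at this

end TotallyRamified

/-! ### Unramified graded division rings -/

/-- The trivial grading of a ring, concentrated in the only degree of the trivial group. -/
def trivialGrading (A : Type u) [Ring A] : PUnit.{1} → AddSubgroup A := fun _ => ⊤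

instance (A : Type u) [Ring A] : GradedRing (trivialGrading A) where
  one_mem := trivial
  mul_mem _ _ _ _ _ _ := trivial
  decompose' x := DirectSum.of (fun i => trivialGrading A i) PUnit.unit ⟨x, trivial⟩
  left_inv x := by simp
  right_inv x := by
    induction x using DirectSum.induction_on with
    | zero =>
      rw [map_zero]
      exact map_zero (DirectSum.of (fun i => trivialGrading A i) PUnit.unit)
    | of i x => simp
    | add x y hx hy =>
      rw [map_add]
      nth_rewrite 2 [← hx]
      nth_rewrite 2 [← hy]
      exact map_add (DirectSum.of (fun i => trivialGrading A i) PUnit.unit) ⟨_, trivial⟩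
        ⟨_, trivial⟩

section ZeroPartDivision

variable {Γ : Type v} [AddCommGroup Γ] [DecidableEq Γ] {E : Type u} [Ring E]
  (𝒜 : Γ → AddSubgroup E) [GradedRing 𝒜] [IsGradedDivisionRing 𝒜]

instance isGradedDivisionRing_zeroPart : IsGradedDivisionRing (trivialGrading (ZeroPart 𝒜)) where
  toNontrivial := by
    have : Nontrivial E := IsGradedDivisionRing.toNontrivial 𝒜
    infer_instance
  isUnit_of_mem := by
    intro _ a _ h0
    have h1 : (a : E) ≠ 0 := fun h => h0 (Subtype.ext h)
    obtain ⟨x, hx⟩ := isUnit_of_mem a.2 h1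
    obtain ⟨u, hu⟩ := exists_zeroUnits (𝒜 := 𝒜) (x := x) (by rw [hx]; exact a.2)
    refine ⟨u, Subtype.ext ?_⟩
    rw [← hx, ← hu, coe_zeroUnits]

end ZeroPartDivision

section Unramified

variable {Γ : Type v} [AddCommGroup Γ] [IsAddTorsionFree Γ] [DecidableEq Γ] {E : Type u} [Ring E]
  {𝒜 : Γ → AddSubgroup E} [GradedRing 𝒜] [IsGradedDivisionRing 𝒜]
  (h : IsUnramified 𝒜)
include h

theorem IsUnramified.mem_center {γ : Γ} {a : E} (ha : a ∈ 𝒜 γ) (h0 : a ≠ 0) :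
    γ ∈ centerGradeGroup 𝒜 := by
  rw [← show gradeGroup 𝒜 = centerGradeGroup 𝒜 from h]
  exact mem_gradeGroup_of_mem ha h0

/-- Homogeneous elements are products of elements of `E₀` and central units. -/
theorem IsUnramified.exists_mul {γ : Γ} {a : E} (ha : a ∈ 𝒜 γ) (h0 : a ≠ 0) :
    ∃ (y : ZeroPart 𝒜) (t : Eˣ), a = y * t ∧ (t : E) ∈ 𝒜 γ ∧ (∀ z : E, z * t = t * z) := by
  obtain ⟨x, rfl⟩ := isUnit_of_mem ha h0
  obtain ⟨u, t, hx, ht, htc⟩ := exists_zeroUnits_mul_central ha (h.mem_center ha h0)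
  exact ⟨u, t, by rw [hx, Units.val_mul, coe_zeroUnits], ht, htc⟩

/-- Degree-zero multiples of a homogeneous `T`-basis of `E` span `E₀` over its center. -/
theorem IsUnramified.finite_zeroPart [Module.Finite (Subring.center E) E] :
    Module.Finite (Subring.center (ZeroPart 𝒜)) (ZeroPart 𝒜) := by
  have := nontrivial_center 𝒜
  have : Nontrivial E := IsGradedDivisionRing.toNontrivial 𝒜
  obtain ⟨n, b, β, hb⟩ := (isGradedScalars_center (𝒜 := 𝒜)).exists_homogeneous_basis_top
  choose y t hbt ht htc using fun i => h.exists_mul (hb i) (b.ne_zero i)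
  refine Module.Finite.of_surjective
    (Fintype.linearCombination (Subring.center (ZeroPart 𝒜)) y) fun x => ?_
  have hc : ∀ i, (b.repr (x : E) i : E) * t i ∈ 𝒜 0 := by
    intro i
    have h1 := (isGradedScalars_center (𝒜 := 𝒜)).repr_mem b hb x.2 i
    rw [Subring.smul_def, smul_eq_mul, mul_one] at h1
    have := mul_mem_add h1 (ht i)
    rwa [zero_sub, neg_add_cancel] at this
  refine ⟨fun i => ⟨⟨_, hc i⟩, ?_⟩, ?_⟩
  · rw [Subring.mem_center_iff]
    intro z
    refine Subtype.ext ?_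
    have := Subring.mem_center_iff.mp (b.repr (x : E) i).2 (z : E)
    change (z : E) * ((b.repr (x : E) i : E) * t i) = (b.repr (x : E) i : E) * t i * z
    rw [← mul_assoc, this, mul_assoc, htc, mul_assoc]
  · refine Subtype.ext ?_
    rw [Fintype.linearCombination_apply, AddSubmonoidClass.coe_finsetSum]
    conv_rhs => rw [← b.sum_repr (x : E)]
    refine Finset.sum_congr rfl fun i _ => ?_
    change (b.repr (x : E) i : E) * t i * y i = (b.repr (x : E) i : E) * b i
    rw [mul_assoc, ← htc i (y i), hbt]

/-- If `L₀` is a maximal subfield of `E₀`, then `L = L₀ T` is a self-centralizing graded subfield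
of `E`, and an `L₀`-basis of `E₀` is an `L`-basis of `E`; so the two reduced norms of elements of
`E₀` are given by the same determinants. -/
theorem IsUnramified.isReducedNorm_one_iff [Module.Finite (Subring.center E) E]
    (a : ZeroPart 𝒜) : IsReducedNorm (a : E) 1 ↔ IsReducedNorm a 1 := by
  classical
  have := h.finite_zeroPart
  obtain ⟨L₀, hL₀⟩ := exists_isSelfCentralizing (trivialGrading (ZeroPart 𝒜))
  have := hL₀.isMulCommutative
  have := hL₀.nontrivial
  obtain ⟨n, b₀, β₀, hb₀⟩ := hL₀.exists_basis
  let X : Set E := (fun z : ZeroPart 𝒜 => (z : E)) '' L₀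
  have hX0 : ∀ x ∈ X, x ∈ 𝒜 0 := by rintro _ ⟨z, -, rfl⟩; exact z.2
  have hXh : IsHomogeneousSet 𝒜 X := by
    intro x hx γ
    by_cases hγ : 0 = γ
    · subst hγ; rw [proj_of_mem (hX0 x hx)]; exact hx
    · rw [proj_of_mem_ne (hX0 x hx) hγ]; exact ⟨0, L₀.zero_mem, rfl⟩
  let L : Subalgebra (Subring.center E) E := Subalgebra.centralizer _ X
  have hmemL : ∀ {x : E}, x ∈ L ↔ ∀ z ∈ L₀, (z : E) * x = x * z := by
    intro x
    constructor
    · intro hx z hz; exact hx _ ⟨z, hz, rfl⟩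
    · rintro hx _ ⟨z, hz, rfl⟩; exact hx z hz
  have hL₀L : ∀ z ∈ L₀, (z : E) ∈ L := fun z hz => hmemL.mpr fun w hw =>
    congrArg Subtype.val (hL₀.mul_comm hw hz)
  have hLL₀ : ∀ z : ZeroPart 𝒜, (z : E) ∈ L → z ∈ L₀ := fun z hz =>
    hL₀.mem_of_commute fun w hw => Subtype.ext (hmemL.mp hz w hw)
  have hLh : IsHomogeneousSet 𝒜 (L : Set E) := by
    rw [Subalgebra.coe_centralizer]; exact hXh.centralizer
  have htL : ∀ t : E, (∀ z : E, z * t = t * z) → t ∈ L := fun t ht => hmemL.mpr fun w _ => ht w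
  -- homogeneous elements of `L` are products of elements of `L₀` and central units
  have hLmul : ∀ {γ : Γ} {x : E}, x ∈ 𝒜 γ → x ∈ L → x ≠ 0 → ∃ z ∈ L₀, ∃ t : Eˣ,
      x = z * t ∧ (t : E) ∈ 𝒜 γ ∧ ∀ w : E, w * t = t * w := by
    intro γ x hx hxL h0
    obtain ⟨z, t, rfl, ht, htc⟩ := h.exists_mul hx h0
    refine ⟨z, hLL₀ z ?_, t, rfl, ht, htc⟩
    refine hmemL.mpr fun w hw => ?_
    have h1 := hmemL.mp hxL w hw
    rw [← mul_assoc, mul_assoc _ _ (w : E), ← htc, ← mul_assoc] at h1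
    exact t.isUnit.mul_right_cancel h1
  have hL : IsSelfCentralizing 𝒜 L := by
    refine ⟨hLh, Set.Subset.antisymm ?_ ?_⟩
    · intro x hx
      exact hmemL.mpr fun z hz => hx z (hL₀L z hz)
    · intro x hx
      refine commute_of_forall_proj hLh fun y hy γ hyγ => ?_
      by_cases h0 : y = 0
      · rw [h0, zero_mul, mul_zero]
      · obtain ⟨z, hz, t, rfl, -, htc⟩ := hLmul hyγ hy h0
        rw [mul_assoc, ← htc, ← mul_assoc, hmemL.mp hx z hz, mul_assoc]
  have := hL.isMulCommutative
  let j : L₀ →+* L :=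
    { toFun := fun z => ⟨(z : ZeroPart 𝒜), hL₀L z z.2⟩
      map_one' := rfl
      map_mul' := fun _ _ => rfl
      map_zero' := rfl
      map_add' := fun _ _ => rfl }
  have hj : ∀ (z : L₀) (x : ZeroPart 𝒜), j z • (x : E) = ((z • x : ZeroPart 𝒜) : E) :=
    fun _ _ => rfl
  have hjinj : Function.Injective j := fun x y hxy =>
    Subtype.ext (Subtype.ext (congrArg (fun w : L => (w : E)) hxy))
  let v : Fin n → E := fun i => (b₀ i : E)
  have hv : ∀ i, v i ∈ 𝒜 0 := fun i => (b₀ i).2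
  have hli : LinearIndependent L v := by
    refine hL.isGradedScalars.linearIndependent (β := fun _ => 0) hv fun s γ c hc hsum i hi => ?_
    by_contra hci
    have hc' : ∀ k ∈ s, ((c k : L) : E) ∈ 𝒜 γ := by
      intro k hk
      have := hc k hk
      rwa [Subalgebra.smul_def, smul_eq_mul, mul_one, sub_zero] at this
    have hci' : ((c i : L) : E) ≠ 0 := fun h0 => hci (Subtype.ext h0)
    obtain ⟨z, hz, t, hczt, ht, htc⟩ := hLmul (hc' i hi) (c i).2 hci'
    -- divide the relation by the central unit `t`
    have htinv : ∀ w : E, w * ((t⁻¹ : Eˣ) : E) = ((t⁻¹ : Eˣ) : E) * w := by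
      intro w
      have := htc (((t⁻¹ : Eˣ) : E) * w * ((t⁻¹ : Eˣ) : E))
      rw [Units.inv_mul_cancel_right] at this
      rw [this]
      simp [mul_assoc]
    have hd0 : ∀ k ∈ s, ((t⁻¹ : Eˣ) : E) * c k ∈ 𝒜 0 := by
      intro k hk
      have := mul_mem_add (inv_mem_neg ht) (hc' k hk)
      rwa [neg_add_cancel] at this
    let d : Fin n → L₀ := fun k => if hk : k ∈ s then ⟨⟨_, hd0 k hk⟩,
      hLL₀ _ (L.mul_mem (htL _ htinv) (c k).2)⟩ else 0
    have hd : ∀ k ∈ s, ((d k : ZeroPart 𝒜) : E) = ((t⁻¹ : Eˣ) : E) * c k := by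
      intro k hk
      simp only [d, dif_pos hk]
    have hsum0 : ∑ k ∈ s, d k • b₀ k = 0 := by
      refine Subtype.ext ?_
      rw [AddSubmonoidClass.coe_finsetSum]
      have h1 : ∑ k ∈ s, ((d k • b₀ k : ZeroPart 𝒜) : E)
          = ((t⁻¹ : Eˣ) : E) * ∑ k ∈ s, c k • v k := by
        rw [Finset.mul_sum]
        refine Finset.sum_congr rfl fun k hk => ?_
        change ((d k : ZeroPart 𝒜) : E) * (b₀ k : E) = ((t⁻¹ : Eˣ) : E) * ((c k : E) * (b₀ k : E))
        rw [hd k hk, mul_assoc]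
      rw [h1, hsum, mul_zero]
      rfl
    have h2 := linearIndependent_iff'.mp b₀.linearIndependent s d hsum0 i hi
    have h3 := hd i hi
    rw [h2] at h3
    exact hci' (by simpa using h3.symm)
  have hspan : ⊤ ≤ Submodule.span L (Set.range v) := by
    intro x _
    obtain ⟨S, -, hS⟩ := exists_sum_proj 𝒜 x
    rw [← hS]
    refine Submodule.sum_mem _ fun γ _ => ?_
    by_cases h0 : GradedRing.proj 𝒜 γ x = 0
    · rw [h0]; exact Submodule.zero_mem _
    · obtain ⟨y, t, hyt, -, htc⟩ := h.exists_mul (proj_mem 𝒜 γ x) h0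
      have h1 : GradedRing.proj 𝒜 γ x = (⟨t, htL t htc⟩ : L) • (y : E) := by
        rw [hyt, htc]; rfl
      rw [h1, ← b₀.sum_repr y, AddSubmonoidClass.coe_finsetSum]
      refine Submodule.smul_mem _ _ (Submodule.sum_mem _ fun i _ => ?_)
      rw [← hj]
      exact Submodule.smul_mem _ _ (Submodule.subset_span ⟨i, rfl⟩)
  let b : Module.Basis (Fin n) L E := Module.Basis.mk hli hspan
  have hbv : ∀ i, b i = (b₀ i : E) := fun i => Module.Basis.mk_apply hli hspan i
  have hmat : rightMulMatrix b (a : E) = j.mapMatrix (rightMulMatrix b₀ a) := by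
    refine Matrix.ext fun i k => ?_
    rw [rightMulMatrix_apply, RingHom.mapMatrix_apply, Matrix.map_apply, rightMulMatrix_apply]
    have h1 : b i * (a : E) = ∑ k, j (b₀.repr (b₀ i * a) k) • b k := by
      have h2 : b i * (a : E) = ((b₀ i * a : ZeroPart 𝒜) : E) := by rw [hbv]; rfl
      rw [h2]
      conv_lhs => rw [← b₀.sum_repr (b₀ i * a), AddSubmonoidClass.coe_finsetSum]
      exact Finset.sum_congr rfl fun k _ => by rw [hbv, hj]
    rw [h1, b.repr_sum_self]
  rw [hL.isReducedNorm_iff b (β := fun _ => 0) (fun i => by rw [hbv]; exact (b₀ i).2),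
    hL₀.isReducedNorm_iff b₀ hb₀, hmat, ← RingHom.map_det, map_one, map_one]
  exact map_eq_one_iff j hjinj

theorem IsUnramified.sk1_mulEquiv [Module.Finite (Subring.center E) E] :
    Nonempty (SK1 E ≃* SK1 (ZeroPart 𝒜)) := by
  refine nonempty_subquotient_mulEquiv (zeroUnits 𝒜) (zeroUnits_injective 𝒜) ?_ ?_
  · ext x
    constructor
    · rintro ⟨u, hu, rfl⟩
      exact (h.isReducedNorm_one_iff _).mpr hu
    · intro hx
      obtain ⟨L, hL⟩ := exists_isSelfCentralizing 𝒜
      have := hL.isMulCommutative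
      obtain ⟨γ, hγ⟩ := exists_degree (𝒜 := 𝒜) x
      obtain ⟨u, rfl⟩ := exists_zeroUnits (hL.mem_zero_of_isReducedNorm_one hγ hx)
      exact ⟨u, (h.isReducedNorm_one_iff _).mp hx, rfl⟩
  · refine le_antisymm ?_ ?_
    · rw [commutator_def, Subgroup.map_commutator, commutator_def]
      exact Subgroup.commutator_mono le_top le_top
    · have hmul : ∀ x : Eˣ, ∃ (u : (ZeroPart 𝒜)ˣ) (t : Eˣ), x = zeroUnits 𝒜 u * t ∧
          ∀ z : Eˣ, z * t = t * z := by
        intro x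
        obtain ⟨γ, hγ⟩ := exists_degree_mem (𝒜 := 𝒜) x
        obtain ⟨u, t, hx, -, ht⟩ := exists_zeroUnits_mul_central hγ
          (show (γ : Γ) ∈ centerGradeGroup 𝒜 from
            (show gradeGroup 𝒜 = centerGradeGroup 𝒜 from h) ▸ γ.2)
        exact ⟨u, t, hx, fun z => Units.ext (ht z)⟩
      rw [commutator_def, Subgroup.commutator_le]
      intro x _ y _
      obtain ⟨u, t, rfl, ht⟩ := hmul x
      obtain ⟨w, s, rfl, hs⟩ := hmul y
      refine ⟨⁅u, w⁆, Subgroup.commutator_mem_commutator trivial trivial, ?_⟩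
      rw [map_commutatorElement, commutatorElement_mul_central_left ht,
        commutatorElement_mul_central_right hs]

end Unramified

/-! ### The commutator pairing modulo the augmentation part -/

/-- A homomorphism on `G ∧ G` is trivial if it is trivial on the elements `σ ∧ τ`. -/
theorem wedge_hom_eq_one {G H : Type*} [Group G] [IsMulCommutative G] [Group H]
    (α : Multiplicative (⋀[ℤ]^2 (Additive G)) →* H)
    (h : ∀ σ τ : G, α (Multiplicative.ofAdd
      (exteriorPower.ιMulti ℤ 2 ![Additive.ofMul σ, Additive.ofMul τ])) = 1)
    (z : Multiplicative (⋀[ℤ]^2 (Additive G))) : α z = 1 := by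
  have hle : Submodule.span ℤ (Set.range (exteriorPower.ιMulti ℤ 2 (M := Additive G))) ≤
      AddSubgroup.toIntSubmodule (MonoidHom.toAdditiveRight α).ker := by
    rw [Submodule.span_le]
    rintro _ ⟨v, rfl⟩
    have hv : v = ![Additive.ofMul (v 0).toMul, Additive.ofMul (v 1).toMul] := by
      ext j; fin_cases j <;> simp
    rw [hv]
    exact h _ _
  have hz : Multiplicative.toAdd z ∈
      Submodule.span ℤ (Set.range (exteriorPower.ιMulti ℤ 2 (M := Additive G))) := by
    rw [exteriorPower.ιMulti_span]; trivial
  exact hle hz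

section Pairing

variable {U : Type*} [Group U] {G : Type u} [Group G] [Finite G] [IsMulCommutative G]
  {A : Type v} [CommGroup A] [MulDistribMulAction G A] (i : A →* U) (hi : Function.Injective i)
  (p : U →* G) (hp : Function.Surjective p) (hconj : ∀ x a, i (p x • a) = x * i a * x⁻¹)
  (hker : ∀ x, p x = 1 → ∃ a t, x = i a * t ∧ ∀ z, z * t = t * z)
  (c : U → U → A) (hc : ∀ x y, i (c x y) = ⁅x, y⁆) (hcN : ∀ x y, c x y ∈ (normMap G A).ker)

/-- The class in `Ĥ⁻¹(G, A)` of the commutator of `x` and `y`. -/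
noncomputable def commutatorClass (x y : U) : TateHMinusOne G A :=
  QuotientGroup.mk (⟨c x y, hcN x y⟩ : (normMap G A).ker)

theorem mk_eq_one_of_mem {a : (normMap G A).ker} (h : (a : A) ∈ augmentationPart G A) :
    (QuotientGroup.mk a : TateHMinusOne G A) = 1 :=
  (QuotientGroup.eq_one_iff a).mpr h

theorem div_smul_mem (g : G) (a : A) : a / g • a ∈ augmentationPart G A :=
  Subgroup.subset_closure ⟨a, g, rfl⟩

include hi hc

theorem commutatorClass_self (x : U) : commutatorClass c hcN x x = 1 := by
  refine mk_eq_one_of_mem ?_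
  have : c x x = 1 := hi (by rw [hc, map_one, commutatorElement_self])
  change c x x ∈ _
  rw [this]
  exact Subgroup.one_mem _

theorem commutatorClass_inv (x y : U) :
    (commutatorClass c hcN x y)⁻¹ = commutatorClass c hcN y x := by
  have : (c x y)⁻¹ = c y x := hi (by rw [map_inv, hc, hc, commutatorElement_inv])
  exact congrArg QuotientGroup.mk (Subtype.ext this)

include hconj in
theorem commutatorClass_mul_left (x x' y : U) : commutatorClass c hcN (x * x') y =
    commutatorClass c hcN x y * commutatorClass c hcN x' y := by
  have h1 : c (x * x') y = (p x • c x' y) * c x y := hi (by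
    rw [map_mul, hconj, hc, hc, hc]
    simp only [commutatorElement_def]
    group)
  refine (QuotientGroup.eq.mpr ?_)
  have h2 : (c (x * x') y)⁻¹ * (c x y * c x' y) = c x' y / p x • c x' y := by
    rw [h1, div_eq_mul_inv]
    rw [mul_inv, mul_comm (c x y), mul_mul_mul_comm, inv_mul_cancel, mul_one, mul_comm]
  rw [Subgroup.mem_subgroupOf]
  change (c (x * x') y)⁻¹ * (c x y * c x' y) ∈ _
  rw [h2]
  exact div_smul_mem _ _

include hconj in
theorem commutatorClass_mul_right (x y y' : U) : commutatorClass c hcN x (y * y') =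
    commutatorClass c hcN x y * commutatorClass c hcN x y' := by
  rw [← commutatorClass_inv i hi c hc, commutatorClass_mul_left i hi p hconj c hc, mul_inv,
    commutatorClass_inv i hi c hc, commutatorClass_inv i hi c hc]

include hconj hker in
theorem commutatorClass_of_ker {x : U} (hx : p x = 1) (y : U) : commutatorClass c hcN x y = 1 := by
  obtain ⟨a, t, rfl, ht⟩ := hker x hx
  refine mk_eq_one_of_mem ?_
  have : c (i a * t) y = a / p y • a := hi (by
    rw [hc, commutatorElement_mul_central_left ht, map_div, hconj, commutatorElement_def, div_eq_mul_inv]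
    group)
  change c (i a * t) y ∈ _
  rw [this]
  exact div_smul_mem _ _

include hconj hker in
theorem commutatorClass_congr_left {x x' : U} (h : p x = p x') (y : U) :
    commutatorClass c hcN x y = commutatorClass c hcN x' y := by
  have h1 := commutatorClass_mul_left i hi p hconj c hc hcN x' (x'⁻¹ * x) y
  rwa [mul_inv_cancel_left, commutatorClass_of_ker i hi p hconj hker c hc hcN
    (x := x'⁻¹ * x) (by rw [map_mul, map_inv, h, inv_mul_cancel]), mul_one] at h1

include hconj hker in
theorem commutatorClass_congr {x x' y y' : U} (hx : p x = p x') (hy : p y = p y') :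
    commutatorClass c hcN x y = commutatorClass c hcN x' y' := by
  rw [commutatorClass_congr_left i hi p hconj hker c hc hcN hx,
    ← commutatorClass_inv i hi c hc, commutatorClass_congr_left i hi p hconj hker c hc hcN hy,
    commutatorClass_inv i hi c hc]

include hconj hker in
/-- The commutator pairing as a homomorphism on `G ∧ G`. -/
theorem exists_wedge_hom (hp : Function.Surjective p) :
    ∃ α : Multiplicative (⋀[ℤ]^2 (Additive G)) →* TateHMinusOne G A, ∀ x y,
      α (Multiplicative.ofAdd (exteriorPower.ιMulti ℤ 2
        ![Additive.ofMul (p x), Additive.ofMul (p y)])) = commutatorClass c hcN x y := by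
  let s := Function.surjInv hp
  have hs : ∀ g, p (s g) = g := Function.surjInv_eq hp
  let κ : G → G → TateHMinusOne G A := fun g g' => commutatorClass c hcN (s g) (s g')
  have hκ : ∀ x y, κ (p x) (p y) = commutatorClass c hcN x y := fun x y =>
    commutatorClass_congr i hi p hconj hker c hc hcN (hs _) (hs _)
  have hl : ∀ g g' g'', κ (g * g') g'' = κ g g'' * κ g' g'' := by
    intro g g' g''
    rw [← hs g, ← hs g', ← hs g'', ← map_mul, hκ, hκ, hκ,
      commutatorClass_mul_left i hi p hconj c hc]
  have hr : ∀ g g' g'', κ g (g' * g'') = κ g g' * κ g g'' := by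
    intro g g' g''
    rw [← hs g, ← hs g', ← hs g'', ← map_mul, hκ, hκ, hκ,
      commutatorClass_mul_right i hi p hconj c hc]
  let B : Additive G →+ Additive G →+ Additive (TateHMinusOne G A) :=
    AddMonoidHom.mk' (fun g => AddMonoidHom.mk'
      (fun g' => Additive.ofMul (κ g.toMul g'.toMul)) (fun a b => hr _ _ _))
      (fun a b => AddMonoidHom.ext fun g => hl _ _ _)
  let f : Additive G [⋀^Fin 2]→ₗ[ℤ] Additive (TateHMinusOne G A) :=
    { toFun := fun v => B (v 0) (v 1)
      map_update_add' := by
        intro _ v j a b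
        obtain rfl := Subsingleton.elim ‹DecidableEq (Fin 2)› (instDecidableEqFin 2)
        fin_cases j <;> simp
      map_update_smul' := by
        intro _ v j n a
        obtain rfl := Subsingleton.elim ‹DecidableEq (Fin 2)› (instDecidableEqFin 2)
        fin_cases j <;> simp
      map_eq_zero_of_eq' := by
        intro v j k hjk hne
        have h01 : v 0 = v 1 := by
          fin_cases j <;> fin_cases k <;> simp_all
        change B (v 0) (v 1) = 0
        rw [h01]
        exact congrArg Additive.ofMul (commutatorClass_self i hi c hc hcN _) }
  refine ⟨AddMonoidHom.toMultiplicativeLeft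
    (exteriorPower.alternatingMapLinearEquiv f).toAddMonoidHom, fun x y => ?_⟩
  have h := exteriorPower.alternatingMapLinearEquiv_apply_ιMulti f
    ![Additive.ofMul (p x), Additive.ofMul (p y)]
  exact (congrArg Additive.toMul h).trans (hκ x y)

omit c hc in
include hconj hker in
/-- Let `U` be a group with an action of `U` on `A` through `p : U → G`, induced by conjugation on
the subgroup `A` of `U`, such that commutators of `U` lie in `A` and the kernel of `p` is generated
by `A` and central elements.  The commutator subgroup of `U` is generated modulo the augmentation
part by the values of the commutator pairing on `G ∧ G`. -/
theorem exists_exact_sequence (hp : Function.Surjective p) (P : Subgroup U)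
    (hcomm : ∀ x y : U, ∃ a, i a = ⁅x, y⁆) (hPc : commutator U ≤ P)
    (hP : ∀ x, x ∈ P ↔ ∃ a ∈ (normMap G A).ker, i a = x) :
    ∃ (α : Multiplicative (⋀[ℤ]^2 (Additive G)) →* TateHMinusOne G A)
      (β : TateHMinusOne G A →* P ⧸ (commutator U).subgroupOf P),
      (∀ x y, ∃ a : (normMap G A).ker, i a = ⁅x, y⁆ ∧
        QuotientGroup.mk a = α (Multiplicative.ofAdd (exteriorPower.ιMulti ℤ 2
          ![Additive.ofMul (p x), Additive.ofMul (p y)]))) ∧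
      (∀ a : (normMap G A).ker, ∃ b : P, (b : U) = i a ∧
        QuotientGroup.mk b = β (QuotientGroup.mk a)) ∧
      α.range = β.ker ∧ Function.Surjective β := by
  choose c hc using hcomm
  have hcP : ∀ x y : U, ⁅x, y⁆ ∈ commutator U := fun x y =>
    Subgroup.commutator_mem_commutator trivial trivial
  have hcN : ∀ x y, c x y ∈ (normMap G A).ker := by
    intro x y
    obtain ⟨a, ha, hax⟩ := (hP _).mp (hPc (hcP x y))
    rw [← hc] at hax
    rwa [← hi hax]
  obtain ⟨α, hα⟩ := exists_wedge_hom i hi p hconj hker c hc hcN hp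
  let f : (normMap G A).ker →* P :=
    (i.comp (normMap G A).ker.subtype).codRestrict P fun a => (hP _).mpr ⟨a, a.2, rfl⟩
  have hf : (augmentationPart G A).subgroupOf (normMap G A).ker ≤
      ((commutator U).subgroupOf P).comap f := by
    have h1 : augmentationPart G A ≤ (commutator U).comap i := by
      rw [augmentationPart, Subgroup.closure_le]
      rintro _ ⟨a, g, rfl⟩
      obtain ⟨x, rfl⟩ := hp g
      change i (a / p x • a) ∈ commutator U
      have : i (a / p x • a) = ⁅i a, x⁆ := by
        rw [map_div, hconj, commutatorElement_def, div_eq_mul_inv]; group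
      rw [this]
      exact hcP _ _
    intro a ha
    exact h1 ha
  let β : TateHMinusOne G A →* P ⧸ (commutator U).subgroupOf P := QuotientGroup.map _ _ f hf
  have hβ : ∀ a : (normMap G A).ker, β (QuotientGroup.mk a) = QuotientGroup.mk (f a) :=
    fun _ => rfl
  refine ⟨α, β, fun x y => ⟨⟨c x y, hcN x y⟩, hc x y, (hα x y).symm⟩,
    fun a => ⟨f a, rfl, rfl⟩, le_antisymm ?_ ?_, ?_⟩
  · rintro _ ⟨z, rfl⟩
    rw [MonoidHom.mem_ker]
    refine wedge_hom_eq_one (β.comp α) (fun σ τ => ?_) z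
    obtain ⟨x, rfl⟩ := hp σ
    obtain ⟨y, rfl⟩ := hp τ
    change β (α (Multiplicative.ofAdd _)) = 1
    rw [hα]
    refine (QuotientGroup.eq_one_iff _).mpr ?_
    rw [Subgroup.mem_subgroupOf]
    change i (c x y) ∈ _
    rw [hc]
    exact hcP x y
  · intro q hq
    obtain ⟨a, rfl⟩ := QuotientGroup.mk_surjective q
    rw [MonoidHom.mem_ker, hβ, QuotientGroup.eq_one_iff, Subgroup.mem_subgroupOf] at hq
    have hle : commutator U ≤ (α.range.comap (QuotientGroup.mk' _)).map
        (i.comp (normMap G A).ker.subtype) := by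
      rw [commutator_def, Subgroup.commutator_le]
      intro x _ y _
      exact ⟨⟨c x y, hcN x y⟩, ⟨_, hα x y⟩, hc x y⟩
    obtain ⟨a', ha', haa⟩ := hle hq
    have : a' = a := Subtype.ext (hi haa)
    rw [← this]
    exact ha'
  · intro q
    obtain ⟨b, rfl⟩ := QuotientGroup.mk_surjective q
    obtain ⟨a, ha, hab⟩ := (hP b).mp b.2
    exact ⟨QuotientGroup.mk ⟨a, ha⟩, congrArg QuotientGroup.mk (Subtype.ext hab)⟩

end Pairing

/-! ### Semiramified graded division rings -/

/-- Artin's theorem: a group of automorphisms with fixed field `F` is the whole Galois group. -/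
theorem artin_of_field {F K : Type*} [Field F] [Field K] [Algebra F K]
    (hfin : 0 < Module.finrank F K) (H : Subgroup (K ≃ₐ[F] K))
    (hfix : ∀ a : K, (∀ σ ∈ H, σ a = a) → ∃ r, algebraMap F K r = a) :
    H = ⊤ ∧ Finite (K ≃ₐ[F] K) ∧ Nat.card (K ≃ₐ[F] K) = Module.finrank F K := by
  have : FiniteDimensional F K := FiniteDimensional.of_finrank_pos hfin
  have hbot : IntermediateField.fixedField H = ⊥ := by
    refine le_antisymm (fun a ha => ?_) bot_le
    obtain ⟨r, rfl⟩ := hfix a fun σ hσ => ha ⟨σ, hσ⟩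
    exact IntermediateField.algebraMap_mem _ r
  have htop : H = ⊤ := by
    rw [← IntermediateField.fixingSubgroup_fixedField H, hbot, IntermediateField.fixingSubgroup_bot]
  have : IsGalois F K := IsGalois.of_fixedField_eq_bot F K (by rw [← htop, hbot])
  exact ⟨htop, inferInstance, IsGalois.card_aut_eq_finrank F K⟩

theorem artin_of_isField {F K : Type*} [CommRing F] [Ring K] [Algebra F K] (hF : IsField F)
    (hK : IsField K) (hfin : 0 < Module.finrank F K) (H : Subgroup (K ≃ₐ[F] K))
    (hfix : ∀ a : K, (∀ σ ∈ H, σ a = a) → ∃ r, algebraMap F K r = a) :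
    H = ⊤ ∧ Finite (K ≃ₐ[F] K) ∧ Nat.card (K ≃ₐ[F] K) = Module.finrank F K :=
  @artin_of_field F K hF.toField hK.toField ‹_› hfin H hfix

section Conjugation

variable {Γ : Type v} [AddCommGroup Γ] [IsAddTorsionFree Γ] [DecidableEq Γ] {E : Type u} [Ring E]
  (𝒜 : Γ → AddSubgroup E) [GradedRing 𝒜] [IsGradedDivisionRing 𝒜]

/-- Conjugation of `E₀` by units of `E`. -/
def conjAut : Eˣ →* GalZero 𝒜 where
  toFun x :=
    { toFun := fun a => ⟨x * a * ((x⁻¹ : Eˣ) : E), conj_mem_zero x a.2⟩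
      invFun := fun a => ⟨((x⁻¹ : Eˣ) : E) * a * x, by
        have := conj_mem_zero (𝒜 := 𝒜) x⁻¹ a.2
        rwa [inv_inv] at this⟩
      left_inv := fun a => Subtype.ext (by simp [mul_assoc])
      right_inv := fun a => Subtype.ext (by simp [mul_assoc])
      map_mul' := fun a b => Subtype.ext (by simp [mul_assoc])
      map_add' := fun a b => Subtype.ext (by simp [mul_add, add_mul])
      commutes' := fun r => Subtype.ext (by
        have h : (x : E) * ((r : ZeroPart 𝒜) : E) = ((r : ZeroPart 𝒜) : E) * x :=
          Subring.mem_center_iff.mp r.2 (x : E)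
        change (x : E) * ((r : ZeroPart 𝒜) : E) * ((x⁻¹ : Eˣ) : E) = ((r : ZeroPart 𝒜) : E)
        rw [h, Units.mul_inv_cancel_right]) }
  map_one' := AlgEquiv.ext fun a => Subtype.ext (by simp)
  map_mul' x y := AlgEquiv.ext fun a => Subtype.ext (by simp [mul_assoc])

theorem coe_conjAut (x : Eˣ) (a : ZeroPart 𝒜) :
    ((conjAut 𝒜 x a : ZeroPart 𝒜) : E) = x * a * ((x⁻¹ : Eˣ) : E) := rfl

variable {𝒜}

theorem conjActsAs_iff {x : Eˣ} {σ : GalZero 𝒜} : ConjActsAs 𝒜 x σ ↔ conjAut 𝒜 x = σ :=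
  ⟨fun h => AlgEquiv.ext fun a => Subtype.ext (h a).symm, fun h a => by rw [← h]; rfl⟩

theorem isField_centerZero : IsField (CenterZero 𝒜) := by
  have : Nontrivial E := IsGradedDivisionRing.toNontrivial 𝒜
  refine ⟨⟨0, 1, zero_ne_one⟩, mul_comm, fun {a} ha => ?_⟩
  have ha0 : ((a : ZeroPart 𝒜) : E) ≠ 0 := fun h0 => ha (Subtype.ext (Subtype.ext h0))
  obtain ⟨b, hb, hab, hba⟩ := exists_homogeneous_inverse 𝒜 (a : ZeroPart 𝒜).2 ha0
  rw [neg_zero] at hb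
  have hbT : b ∈ Set.centralizer (Set.univ : Set E) :=
    mem_centralizer_of_mul_eq_one (by rw [Set.centralizer_univ]; exact a.2) hab hba
  rw [Set.centralizer_univ] at hbT
  exact ⟨⟨⟨b, hb⟩, hbT⟩, Subtype.ext (Subtype.ext hab)⟩

variable (𝒜) in
include 𝒜 in
theorem mem_center_of_forall_unit {a : E} (h : ∀ x : Eˣ, (x : E) * a = a * x) :
    a ∈ Subring.center E := by
  have : a ∈ Set.centralizer (Set.univ : Set E) := by
    refine commute_of_forall_proj (isHomogeneousSet_univ 𝒜) fun y _ γ hy => ?_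
    by_cases h0 : y = 0
    · rw [h0, zero_mul, mul_zero]
    · obtain ⟨x, rfl⟩ := isUnit_of_mem hy h0
      exact h x
  rwa [Set.centralizer_univ] at this

variable (𝒜) in
/-- The class modulo `Γ_T` of the degree of a unit. -/
noncomputable def degreeClass : Eˣ →* Multiplicative (GradeQuotient 𝒜) where
  toFun x := Multiplicative.ofAdd ((exists_degree_mem (𝒜 := 𝒜) x).choose : GradeQuotient 𝒜)
  map_one' := by
    have : Nontrivial E := IsGradedDivisionRing.toNontrivial 𝒜
    have h := (exists_degree_mem (𝒜 := 𝒜) (1 : Eˣ)).choose_spec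
    have h2 : (exists_degree_mem (𝒜 := 𝒜) (1 : Eˣ)).choose = 0 :=
      Subtype.ext (degree_unique h SetLike.GradedOne.one_mem one_ne_zero)
    rw [h2]
    rfl
  map_mul' x y := by
    have : Nontrivial E := IsGradedDivisionRing.toNontrivial 𝒜
    have hx := (exists_degree_mem (𝒜 := 𝒜) x).choose_spec
    have hy := (exists_degree_mem (𝒜 := 𝒜) y).choose_spec
    have hxy := (exists_degree_mem (𝒜 := 𝒜) (x * y)).choose_spec
    have h2 : (exists_degree_mem (𝒜 := 𝒜) (x * y)).choose =
        (exists_degree_mem (𝒜 := 𝒜) x).choose + (exists_degree_mem (𝒜 := 𝒜) y).choose :=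
      Subtype.ext (degree_unique hxy (mul_mem_add hx hy) (x * y).ne_zero)
    rw [h2]
    rfl

theorem degreeClass_apply {x : Eˣ} {γ : gradeGroup 𝒜} (hx : (x : E) ∈ 𝒜 γ) :
    degreeClass 𝒜 x = Multiplicative.ofAdd (γ : GradeQuotient 𝒜) := by
  have : Nontrivial E := IsGradedDivisionRing.toNontrivial 𝒜
  have h : (exists_degree_mem (𝒜 := 𝒜) x).choose = γ :=
    Subtype.ext (degree_unique (exists_degree_mem (𝒜 := 𝒜) x).choose_spec hx x.ne_zero)
  change Multiplicative.ofAdd ((exists_degree_mem (𝒜 := 𝒜) x).choose : GradeQuotient 𝒜) = _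
  rw [h]

theorem degreeClass_surjective : Function.Surjective (degreeClass 𝒜) := by
  intro q
  obtain ⟨γ, hγ⟩ := QuotientAddGroup.mk_surjective q.toAdd
  obtain ⟨x, hx⟩ := exists_unit_of_mem_gradeGroup γ.2
  exact ⟨x, by rw [degreeClass_apply hx, hγ]; rfl⟩

theorem degreeClass_eq_one {x : Eˣ} (h : degreeClass 𝒜 x = 1) : ∃ (u : (ZeroPart 𝒜)ˣ) (t : Eˣ),
    x = zeroUnits 𝒜 u * t ∧ ∀ y : E, y * t = t * y := by
  obtain ⟨γ, hγ⟩ := exists_degree_mem (𝒜 := 𝒜) x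
  rw [degreeClass_apply hγ] at h
  have h2 : (γ : GradeQuotient 𝒜) = 0 := h
  rw [QuotientAddGroup.eq_zero_iff, AddSubgroup.mem_addSubgroupOf] at h2
  obtain ⟨u, t, hx, -, ht⟩ := exists_zeroUnits_mul_central hγ h2
  exact ⟨u, t, hx, ht⟩

end Conjugation

section Semiramified

variable {Γ : Type v} [AddCommGroup Γ] [IsAddTorsionFree Γ] [DecidableEq Γ] {E : Type u} [Ring E]
  {𝒜 : Γ → AddSubgroup E} [GradedRing 𝒜] [IsGradedDivisionRing 𝒜]

variable (𝒜) in
include 𝒜 in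
theorem ind_pos [Module.Finite (Subring.center E) E] : 0 < ind E := by
  obtain ⟨L, hL⟩ := exists_isSelfCentralizing 𝒜
  have := hL.isMulCommutative
  obtain ⟨n, b, β, hb⟩ := hL.exists_basis
  rw [hL.ind_eq b hb]
  exact hL.pos_of_basis b

variable (h : IsSemiramified 𝒜)
include h

theorem IsSemiramified.conjAut_eq_one_of_degreeClass {x : Eˣ} (hx : degreeClass 𝒜 x = 1) :
    conjAut 𝒜 x = 1 := by
  obtain ⟨u, t, rfl, ht⟩ := degreeClass_eq_one hx
  refine AlgEquiv.ext fun a => Subtype.ext ?_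
  have h1 : ((u : ZeroPart 𝒜) : E) * a = a * (u : ZeroPart 𝒜) :=
    congrArg Subtype.val (h.isField.mul_comm (u : ZeroPart 𝒜) a)
  rw [coe_conjAut, Units.val_mul, coe_zeroUnits, mul_assoc _ _ (a : E), ← ht, ← mul_assoc, h1,
    mul_assoc, mul_assoc]
  change (a : E) * (zeroUnits 𝒜 u * (t * ((zeroUnits 𝒜 u * t)⁻¹ : Eˣ))) = a
  rw [← mul_assoc (zeroUnits 𝒜 u : E), ← Units.val_mul, Units.mul_inv, mul_one]

variable [Module.Finite (Subring.center E) E]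

/-- The automorphisms of `E₀` given by conjugations have fixed field `T₀`, so they exhaust the
Galois group. -/
theorem IsSemiramified.conjAut_surjective_and_card : Function.Surjective (conjAut 𝒜) ∧
    Finite (GalZero 𝒜) ∧ Nat.card (GalZero 𝒜) = ind E := by
  obtain ⟨h1, h2, h3⟩ := artin_of_isField (isField_centerZero (𝒜 := 𝒜)) h.isField
    (by rw [h.finrank_eq]; exact ind_pos 𝒜) (conjAut 𝒜).range (by
      intro a ha
      refine ⟨⟨a, ?_⟩, rfl⟩
      refine mem_center_of_forall_unit 𝒜 fun x => ?_
      have h4 := congrArg Subtype.val (ha _ ⟨x, rfl⟩)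
      rw [coe_conjAut] at h4
      exact (Units.mul_inv_eq_iff_eq_mul x).mp h4)
  exact ⟨MonoidHom.range_eq_top.mp h1, h2, h3.trans h.finrank_eq⟩

/-- The automorphism induced by a unit depends only on its degree modulo `Γ_T`, because `E₀` is
commutative.  The resulting surjection from `Γ_E / Γ_T` is bijective since both groups have order
`ind E`. -/
theorem IsSemiramified.exists_equiv : ∃ θ : GalZero 𝒜 ≃* Multiplicative (GradeQuotient 𝒜),
    ∀ x : Eˣ, θ (conjAut 𝒜 x) = degreeClass 𝒜 x := by
  obtain ⟨hsurj, hfin, hcard⟩ := h.conjAut_surjective_and_card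
  let e := QuotientGroup.quotientKerEquivOfSurjective (degreeClass 𝒜) degreeClass_surjective
  let l : Eˣ ⧸ (degreeClass 𝒜).ker →* GalZero 𝒜 :=
    QuotientGroup.lift (degreeClass 𝒜).ker (conjAut 𝒜) fun x hx =>
      h.conjAut_eq_one_of_degreeClass hx
  let g : Multiplicative (GradeQuotient 𝒜) →* GalZero 𝒜 := l.comp e.symm.toMonoidHom
  have hg : ∀ x, g (degreeClass 𝒜 x) = conjAut 𝒜 x := by
    intro x
    have : e.symm (degreeClass 𝒜 x) = QuotientGroup.mk x := by
      rw [MulEquiv.symm_apply_eq]; rfl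
    change l (e.symm (degreeClass 𝒜 x)) = _
    rw [this]
    rfl
  have hgs : Function.Surjective g := by
    intro σ
    obtain ⟨x, rfl⟩ := hsurj σ
    exact ⟨_, hg x⟩
  have hc : Nat.card (Multiplicative (GradeQuotient 𝒜)) = Nat.card (GalZero 𝒜) := by
    rw [hcard, ← h.index_eq]
    rfl
  have hgb : Function.Bijective g := by
    have : Finite (Multiplicative (GradeQuotient 𝒜)) := Nat.finite_of_card_ne_zero (by
      rw [hc, hcard]; exact (ind_pos 𝒜).ne')
    exact (Function.Surjective.bijective_of_nat_card_le hgs hc.le)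
  refine ⟨(MulEquiv.ofBijective g hgb).symm, fun x => ?_⟩
  rw [MulEquiv.symm_apply_eq]
  exact (hg x).symm

theorem IsSemiramified.degreeClass_eq_one_of_conjAut {x : Eˣ} (hx : conjAut 𝒜 x = 1) :
    degreeClass 𝒜 x = 1 := by
  obtain ⟨θ, hθ⟩ := h.exists_equiv
  rw [← hθ, hx, map_one]

theorem IsSemiramified.isMulCommutative_galZero : IsMulCommutative (GalZero 𝒜) := by
  obtain ⟨θ, -⟩ := h.exists_equiv
  exact ⟨⟨fun a b => θ.injective (by rw [map_mul, map_mul, mul_comm])⟩⟩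

/-- In the semiramified case `L = E₀ T` is a self-centralizing graded subfield, and over it right
multiplication by `a ∈ E₀` is diagonal in a homogeneous basis, the eigenvalues being the conjugates
of `a`. -/
theorem IsSemiramified.isReducedNorm_one_iff [IsMulCommutative (ZeroPart 𝒜)ˣ] [Finite (GalZero 𝒜)]
    (u : (ZeroPart 𝒜)ˣ) :
    IsReducedNorm (zeroUnits 𝒜 u : E) 1 ↔ u ∈ (normMap (GalZero 𝒜) (ZeroPart 𝒜)ˣ).ker := by
  classical
  have hE0 : ∀ {a b : E}, a ∈ 𝒜 0 → b ∈ 𝒜 0 → a * b = b * a := fun {a b} ha hb =>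
    congrArg Subtype.val (h.isField.mul_comm (⟨a, ha⟩ : ZeroPart 𝒜) ⟨b, hb⟩)
  have hXh : IsHomogeneousSet 𝒜 (𝒜 0 : Set E) := by
    intro x hx γ
    by_cases hγ : 0 = γ
    · subst hγ; rw [proj_of_mem hx]; exact hx
    · rw [proj_of_mem_ne hx hγ]; exact (𝒜 0).zero_mem
  let L : Subalgebra (Subring.center E) E := Subalgebra.centralizer _ (𝒜 0 : Set E)
  have hL0 : ∀ {a : E}, a ∈ 𝒜 0 → a ∈ L := fun {a} ha b hb => hE0 hb ha
  have hLh : IsHomogeneousSet 𝒜 (L : Set E) := by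
    rw [Subalgebra.coe_centralizer]; exact hXh.centralizer
  -- units in `L` act trivially on `E₀`
  have hLconj : ∀ x : Eˣ, (x : E) ∈ L ↔ conjAut 𝒜 x = 1 := by
    intro x
    constructor
    · intro hx
      refine AlgEquiv.ext fun a => Subtype.ext ?_
      have h1 : (a : E) * x = x * a := hx _ a.2
      rw [coe_conjAut, ← h1, Units.mul_inv_cancel_right]
      rfl
    · intro hx a ha
      have h1 := coe_conjAut 𝒜 x ⟨a, ha⟩
      rw [hx] at h1
      exact ((Units.eq_mul_inv_iff_mul_eq x).mp h1)
  have hL : IsSelfCentralizing 𝒜 L := by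
    refine ⟨hLh, Set.Subset.antisymm ?_ ?_⟩
    · intro x hx a ha
      exact hx a (hL0 ha)
    · intro x hx
      refine commute_of_forall_proj hLh fun y hy γ hyγ => ?_
      by_cases h0 : y = 0
      · rw [h0, zero_mul, mul_zero]
      · obtain ⟨y, rfl⟩ := isUnit_of_mem hyγ h0
        obtain ⟨w, t, rfl, ht⟩ :=
          degreeClass_eq_one (h.degreeClass_eq_one_of_conjAut ((hLconj y).mp hy))
        have h1 := hx _ (zeroUnits_mem w)
        rw [Units.val_mul, mul_assoc, ← ht, ← mul_assoc, h1, mul_assoc]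
  have := hL.isMulCommutative
  have := hL.nontrivial
  obtain ⟨n, b, β, hb⟩ := hL.exists_basis
  have hn : ind E = n := hL.ind_eq b hb
  have : Nontrivial E := IsGradedDivisionRing.toNontrivial 𝒜
  choose x hx using fun i => isUnit_of_mem (hb i) (b.ne_zero i)
  have hinj : Function.Injective fun i => conjAut 𝒜 (x i) := by
    intro i k hik
    by_contra hne
    have h1 : ((x i * (x k)⁻¹ : Eˣ) : E) ∈ L := by
      rw [hLconj, map_mul, map_inv]
      exact mul_inv_eq_one.mpr hik
    have h2 : b i = (⟨_, h1⟩ : L) • b k := by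
      rw [← hx i, ← hx k]
      change (x i : E) = (x i * (x k)⁻¹ : Eˣ) * x k
      rw [Units.val_mul, Units.inv_mul_cancel_right]
    have h3 := congrArg (fun w => b.repr w i) h2
    simp [Ne.symm hne] at h3
  obtain ⟨-, -, hcard⟩ := h.conjAut_surjective_and_card
  have hbij : Function.Bijective fun i => conjAut 𝒜 (x i) :=
    hinj.bijective_of_nat_card_le (by rw [hcard, hn, Nat.card_fin])
  let k : (ZeroPart 𝒜)ˣ →* L :=
    { toFun := fun w => ⟨zeroUnits 𝒜 w, hL0 (zeroUnits_mem w)⟩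
      map_one' := rfl
      map_mul' := fun _ _ => rfl }
  have hk : Function.Injective k := fun w w' hww =>
    zeroUnits_injective 𝒜 (Units.ext (congrArg (fun z : L => (z : E)) hww))
  have hmat : rightMulMatrix b (zeroUnits 𝒜 u : E) =
      Matrix.diagonal fun i => k (conjAut 𝒜 (x i) • u) := by
    refine Matrix.ext fun i j => ?_
    have h1 : b i * (zeroUnits 𝒜 u : E) = k (conjAut 𝒜 (x i) • u) • b i := by
      rw [Subalgebra.smul_def, smul_eq_mul]
      change _ = (x i : E) * (u : ZeroPart 𝒜) * (((x i)⁻¹ : Eˣ) : E) * b i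
      rw [← hx i, Units.inv_mul_cancel_right, coe_zeroUnits]
    rw [rightMulMatrix_apply, h1, map_smul, Finsupp.smul_apply, b.repr_self,
      Matrix.diagonal_apply, Finsupp.single_apply]
    split_ifs <;> simp
  have hnorm : normMap (GalZero 𝒜) (ZeroPart 𝒜)ˣ u = ∏ i, conjAut 𝒜 (x i) • u := by
    have := Fintype.ofFinite (GalZero 𝒜)
    change ∏ᶠ g : GalZero 𝒜, g • u = _
    rw [finprod_eq_prod_of_fintype]
    exact (Function.Bijective.prod_comp hbij fun g => g • u).symm
  rw [hL.isReducedNorm_iff b hb, hmat, Matrix.det_diagonal, ← map_prod, ← hnorm, map_one,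
    MonoidHom.mem_ker]
  exact map_eq_one_iff k hk

theorem IsSemiramified.exact_sequence :
    ∃ (_ : Finite (GalZero 𝒜)) (_ : IsMulCommutative (GalZero 𝒜))
      (θ : GalZero 𝒜 ≃* Multiplicative (GradeQuotient 𝒜))
      (α : Multiplicative (⋀[ℤ]^2 (Additive (GalZero 𝒜))) →* TateZero 𝒜 h)
      (β : TateZero 𝒜 h →* SK1 E),
      (∀ (γ : gradeGroup 𝒜) (x : Eˣ), (x : E) ∈ 𝒜 γ →
        ConjActsAs 𝒜 x (θ.symm (Multiplicative.ofAdd (γ : GradeQuotient 𝒜)))) ∧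
      (∀ (σ τ : GalZero 𝒜) (x y : Eˣ), ConjActsAs 𝒜 x σ → ConjActsAs 𝒜 y τ →
        TateZero.IsClassOf 𝒜 (α (Multiplicative.ofAdd
            (exteriorPower.ιMulti ℤ 2 ![Additive.ofMul σ, Additive.ofMul τ])))
          ((x * y * x⁻¹ * y⁻¹ : Eˣ) : E)) ∧
      (∀ (q : TateZero 𝒜 h) (a : E),
        TateZero.IsClassOf 𝒜 q a → SK1.IsClassOf (β q) a) ∧
      α.range = β.ker ∧ Function.Surjective β := by
  have := h.isMulCommutative
  obtain ⟨hsurj, hfin, -⟩ := h.conjAut_surjective_and_card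
  obtain ⟨θ, hθ⟩ := h.exists_equiv
  have hcomm := h.isMulCommutative_galZero
  obtain ⟨α, β, hα, hβ, hexact, hβs⟩ := exists_exact_sequence (zeroUnits 𝒜)
    (zeroUnits_injective 𝒜) (conjAut 𝒜) (fun x a => Units.ext rfl)
    (fun x hx => by
      obtain ⟨u, t, hut, ht⟩ := degreeClass_eq_one (h.degreeClass_eq_one_of_conjAut hx)
      exact ⟨u, t, hut, fun z => Units.ext (ht z)⟩) hsurj (reducedNormOne E)
    (fun x y => exists_zeroUnits (commutator_mem_zero x y)) (commutator_le_reducedNormOne E)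
    (fun x => by
      constructor
      · intro hx
        obtain ⟨L, hL⟩ := exists_isSelfCentralizing 𝒜
        have := hL.isMulCommutative
        obtain ⟨γ, hγ⟩ := exists_degree (𝒜 := 𝒜) x
        obtain ⟨u, rfl⟩ := exists_zeroUnits (hL.mem_zero_of_isReducedNorm_one hγ hx)
        exact ⟨u, (h.isReducedNorm_one_iff u).mp hx, rfl⟩
      · rintro ⟨u, hu, rfl⟩
        exact (h.isReducedNorm_one_iff u).mpr hu)
  refine ⟨hfin, hcomm, θ, α, β, ?_, ?_, ?_, hexact, hβs⟩
  · intro γ x hx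
    rw [conjActsAs_iff, ← degreeClass_apply hx, ← hθ, MulEquiv.symm_apply_apply]
  · intro σ τ x y hx hy
    rw [conjActsAs_iff] at hx hy
    subst hx hy
    obtain ⟨a, ha, hac⟩ := hα x y
    exact ⟨a, congrArg Units.val ha, hac⟩
  · rintro q a ⟨c, rfl, rfl⟩
    obtain ⟨b, hb, hbc⟩ := hβ c
    exact ⟨b, congrArg Units.val hb, hbc⟩

end Semiramified

/-! ### Unramified and totally ramified maximal graded subfields -/

section Decomposed

variable {Γ : Type v} [AddCommGroup Γ] [DecidableEq Γ] {E : Type u} [Ring E]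
  {𝒜 : Γ → AddSubgroup E} [GradedRing 𝒜] [IsGradedDivisionRing 𝒜]
  [Module.Finite (Subring.center E) E] {L K : Subalgebra (Subring.center E) E}

theorem coe_smul_one_center (r : Subring.center E) : r • (1 : E) = r := by
  rw [Subring.smul_def, smul_eq_mul, mul_one]

/-- A totally ramified self-centralizing graded subfield contains units whose degrees lie in
`ind E` distinct cosets of `Γ_T`. -/
theorem exists_units_of_totallyRamified (hK : IsSelfCentralizing 𝒜 K)
    (hK0 : ∀ x ∈ K, x ∈ 𝒜 0 → x ∈ Subring.center E) :
    ∃ (y : Fin (ind E) → Eˣ) (κ : Fin (ind E) → Γ), (∀ i, (y i : E) ∈ 𝒜 (κ i)) ∧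
      (∀ i, (y i : E) ∈ K) ∧ ∀ i j, κ i - κ j ∈ centerGradeGroup 𝒜 → i = j := by
  have := hK.isMulCommutative
  have := nontrivial_center 𝒜
  obtain ⟨v, κ, hv, hli, hspan⟩ := hK.exists_center_basis
  have hvK : ∀ i, v i ∈ K := fun i => by
    rw [← Subalgebra.mem_toSubmodule, ← hspan]
    exact Submodule.subset_span ⟨i, rfl⟩
  choose y hy using fun i => isUnit_of_mem (hv i) (hli.ne_zero i)
  refine ⟨y, κ, fun i => by rw [hy]; exact hv i, fun i => by rw [hy]; exact hvK i, ?_⟩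
  intro i j hij
  by_contra hne
  obtain ⟨t, ht, htc⟩ := exists_unit_of_mem_centerGradeGroup hij
  have hyinv : (((y i)⁻¹ : Eˣ) : E) ∈ K :=
    hK.mem_of_mul_eq_one (by rw [hy]; exact hvK i) (y i).mul_inv (y i).inv_mul
  -- `t yⱼ yᵢ⁻¹` has degree `0`
  have hz0 : (t : E) * y j * ((y i)⁻¹ : Eˣ) ∈ 𝒜 0 := by
    have := mul_mem_add (mul_mem_add ht (show (y j : E) ∈ 𝒜 (κ j) by rw [hy]; exact hv j))
      (inv_mem_neg (show (y i : E) ∈ 𝒜 (κ i) by rw [hy]; exact hv i))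
    rwa [show κ i - κ j + κ j + -κ i = 0 by abel] at this
  have htT : (t : E) ∈ Subring.center E := Subring.mem_center_iff.mpr htc
  have hzK : (t : E) * y j * ((y i)⁻¹ : Eˣ) ∈ K :=
    K.mul_mem (K.mul_mem (K.algebraMap_mem ⟨t, htT⟩) (by rw [hy]; exact hvK j)) hyinv
  have hzT := hK0 _ hzK hz0
  have hrel : (⟨t, htT⟩ : Subring.center E) • v j = (⟨_, hzT⟩ : Subring.center E) • v i := by
    rw [← hy i, ← hy j]
    change (t : E) * y j = (t : E) * y j * ((y i)⁻¹ : Eˣ) * y i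
    rw [Units.inv_mul_cancel_right]
  have h1 : Finsupp.single j (⟨t, htT⟩ : Subring.center E) = Finsupp.single i ⟨_, hzT⟩ :=
    hli (by rw [Finsupp.linearCombination_single, Finsupp.linearCombination_single, hrel])
  have h2 := DFunLike.congr_fun h1 j
  rw [Finsupp.single_eq_same, Finsupp.single_apply, if_neg hne] at h2
  have : Nontrivial E := IsGradedDivisionRing.toNontrivial 𝒜
  exact t.ne_zero (congrArg Subtype.val h2)

/-- A homogeneous `T`-basis of an unramified self-centralizing graded subfield can be moved to
degree `0`. -/
theorem finrank_zeroPart_of_unramified (hL : IsSelfCentralizing 𝒜 L)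
    (hLT : ∀ γ, ∀ a ∈ L, a ∈ 𝒜 γ → a ≠ 0 → γ ∈ centerGradeGroup 𝒜)
    (hL0 : ∀ a, a ∈ 𝒜 0 → a ∈ L) :
    Module.finrank (CenterZero 𝒜) (ZeroPart 𝒜) = ind E := by
  have := nontrivial_center 𝒜
  have := isDomain_centerZero 𝒜
  have := hL.isMulCommutative
  obtain ⟨v, κ, hv, hli, hspan⟩ := hL.exists_center_basis
  have hvL : ∀ i, v i ∈ L := fun i => by
    rw [← Subalgebra.mem_toSubmodule, ← hspan]
    exact Submodule.subset_span ⟨i, rfl⟩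
  choose t ht htc using fun i => exists_unit_of_mem_centerGradeGroup
    (hLT _ _ (hvL i) (hv i) (hli.ne_zero i))
  have hw : ∀ i, v i * (((t i)⁻¹ : Eˣ) : E) ∈ 𝒜 0 := by
    intro i
    have := mul_mem_add (hv i) (inv_mem_neg (ht i))
    rwa [add_neg_cancel] at this
  have htT : ∀ i, (t i : E) ∈ Subring.center E := fun i => Subring.mem_center_iff.mpr (htc i)
  have htT' : ∀ i, (((t i)⁻¹ : Eˣ) : E) ∈ Subring.center E := fun i => by
    have h1 : (t i : E) ∈ Set.centralizer (Set.univ : Set E) := by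
      rw [Set.centralizer_univ]; exact htT i
    have := mem_centralizer_of_mul_eq_one h1 (t i).mul_inv (t i).inv_mul
    rwa [Set.centralizer_univ] at this
  let w : Fin (ind E) → ZeroPart 𝒜 := fun i => ⟨_, hw i⟩
  have hwli : LinearIndependent (CenterZero 𝒜) w := by
    rw [Fintype.linearIndependent_iff]
    intro g hg i
    let g' : Fin (ind E) → Subring.center E := fun k =>
      ⟨((g k : ZeroPart 𝒜) : E), (g k).2⟩ * ⟨_, htT' k⟩
    have h1 : ∑ k, g' k • v k = 0 := by
      have h2 := congrArg Subtype.val hg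
      rw [AddSubmonoidClass.coe_finsetSum] at h2
      refine Eq.trans (Finset.sum_congr rfl fun k _ => ?_) h2
      change ((g k : ZeroPart 𝒜) : E) * (((t k)⁻¹ : Eˣ) : E) * v k =
        ((g k : ZeroPart 𝒜) : E) * (v k * (((t k)⁻¹ : Eˣ) : E))
      rw [mul_assoc, Subring.mem_center_iff.mp (htT' k)]
    have h3 := congrArg Subtype.val (Fintype.linearIndependent_iff.mp hli g' h1 i)
    have h4 : ((g i : ZeroPart 𝒜) : E) * (((t i)⁻¹ : Eˣ) : E) = 0 := h3
    rw [Units.mul_left_eq_zero] at h4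
    exact Subtype.ext (Subtype.ext h4)
  have hwspan : ⊤ ≤ Submodule.span (CenterZero 𝒜) (Set.range w) := by
    intro x _
    have hx : (x : E) ∈ Submodule.span (Subring.center E) (Set.range v) := by
      rw [hspan]; exact hL0 _ x.2
    obtain ⟨r, hr⟩ := (Submodule.mem_span_range_iff_exists_fun _).mp hx
    have hc : ∀ i, (r i : E) * t i ∈ 𝒜 0 := by
      intro i
      have h1 := (isGradedScalars_center (𝒜 := 𝒜)).coeff_mem hli hv (γ := 0) (r := r)
        (by rw [hr]; exact x.2) i
      rw [coe_smul_one_center] at h1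
      have := mul_mem_add h1 (ht i)
      rwa [zero_sub, neg_add_cancel] at this
    let c : Fin (ind E) → CenterZero 𝒜 := fun i =>
      ⟨⟨_, hc i⟩, (Subring.center E).mul_mem (r i).2 (htT i)⟩
    refine (Submodule.mem_span_range_iff_exists_fun _).mpr ⟨c, Subtype.ext ?_⟩
    rw [AddSubmonoidClass.coe_finsetSum, ← hr]
    refine Finset.sum_congr rfl fun i _ => ?_
    change (r i : E) * t i * (v i * (((t i)⁻¹ : Eˣ) : E)) = (r i : E) * v i
    rw [mul_assoc, ← mul_assoc (t i : E), ← htc, Units.mul_inv_cancel_right]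
  rw [Module.finrank_eq_card_basis (Module.Basis.mk hwli hwspan), Fintype.card_fin]

/-- The degrees of a homogeneous `L`-basis of `E` meet each of the `ind E` cosets of `Γ_T` met by
`K`, hence they lie in distinct cosets.  So `E₀ ⊆ L`, and every degree of `E` is congruent modulo
`Γ_T` to a degree of `K`. -/
theorem zero_mem_and_degrees (hL : IsSelfCentralizing 𝒜 L)
    (hLT : ∀ γ, ∀ a ∈ L, a ∈ 𝒜 γ → a ≠ 0 → γ ∈ centerGradeGroup 𝒜)
    {y : Fin (ind E) → Eˣ} {κ : Fin (ind E) → Γ} (hy : ∀ i, (y i : E) ∈ 𝒜 (κ i))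
    (hκ : ∀ i j, κ i - κ j ∈ centerGradeGroup 𝒜 → i = j) :
    (∀ a, a ∈ 𝒜 0 → a ∈ L) ∧ ∀ γ ∈ gradeGroup 𝒜, ∃ i, γ - κ i ∈ centerGradeGroup 𝒜 := by
  have := hL.isMulCommutative
  have := hL.nontrivial
  have : Nontrivial E := IsGradedDivisionRing.toNontrivial 𝒜
  obtain ⟨n, b, β, hb⟩ := hL.exists_basis
  obtain rfl : ind E = n := hL.ind_eq b hb
  have hdeg : ∀ {γ : Γ} {x : E}, x ∈ 𝒜 γ → ∀ j, b.repr x j ≠ 0 →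
      γ - β j ∈ centerGradeGroup 𝒜 := by
    intro γ x hx j hj
    have h1 := hL.isGradedScalars.repr_mem b hb hx j
    rw [Subalgebra.smul_def, smul_eq_mul, mul_one] at h1
    exact hLT _ _ (b.repr x j).2 h1 fun h0 => hj (Subtype.ext h0)
  have hex : ∀ {x : E}, x ≠ 0 → ∃ j, b.repr x j ≠ 0 := by
    intro x hx
    by_contra! h0
    exact hx (b.ext_elem fun j => by rw [h0 j, map_zero, Finsupp.zero_apply])
  choose f hf using fun i => hex (y i).ne_zero
  have hfdeg : ∀ i, κ i - β (f i) ∈ centerGradeGroup 𝒜 := fun i => hdeg (hy i) _ (hf i)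
  have hfinj : Function.Injective f := by
    intro i j hij
    refine hκ i j ?_
    have h1 := (centerGradeGroup 𝒜).sub_mem (hfdeg i) (hfdeg j)
    rwa [hij, sub_sub_sub_cancel_right] at h1
  have hfsurj := Finite.surjective_of_injective hfinj
  -- the degrees of the basis lie in distinct cosets
  have hβ : ∀ j k, β j - β k ∈ centerGradeGroup 𝒜 → j = k := by
    intro j k hjk
    obtain ⟨i, rfl⟩ := hfsurj j
    obtain ⟨l, rfl⟩ := hfsurj k
    refine congrArg f (hκ i l ?_)
    have h1 := (centerGradeGroup 𝒜).add_mem ((centerGradeGroup 𝒜).sub_mem (hfdeg i) (hfdeg l)) hjk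
    rwa [show κ i - β (f i) - (κ l - β (f l)) + (β (f i) - β (f l)) = κ i - κ l by abel] at h1
  refine ⟨fun a ha => ?_, fun γ hγ => ?_⟩
  · have h1 : (1 : E) ∈ 𝒜 0 := SetLike.GradedOne.one_mem
    obtain ⟨j, hj⟩ := hex (one_ne_zero (α := E))
    have honly : ∀ {x : E}, x ∈ 𝒜 0 → b.repr x j • b j = x := by
      intro x hx
      refine Eq.trans (Eq.symm ?_) (b.sum_repr x)
      refine Finset.sum_eq_single_of_mem (f := fun k => b.repr x k • b k) j (Finset.mem_univ j)
        fun k _ hkj => ?_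
      by_contra hk
      refine hkj (hβ k j ?_)
      have h2 := (centerGradeGroup 𝒜).sub_mem (hdeg h1 j hj)
        (hdeg hx k fun h0 => hk (by rw [h0, zero_smul]))
      rwa [sub_sub_sub_cancel_left] at h2
    have hr := hL.isGradedScalars.repr_mem b hb h1 j
    obtain ⟨s, -, hs⟩ := hL.isGradedScalars.exists_inv _ _ hr hj
    have hbj : b j = s • (1 : E) := by
      conv_rhs => rw [← honly h1, smul_smul, hs, one_smul]
    rw [← honly ha, hbj, Subalgebra.smul_def, Subalgebra.smul_def, smul_eq_mul, smul_eq_mul,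
      mul_one]
    exact L.mul_mem (b.repr a j).2 s.2
  · obtain ⟨x, hx⟩ := exists_unit_of_mem_gradeGroup hγ
    obtain ⟨j, hj⟩ := hex x.ne_zero
    obtain ⟨i, rfl⟩ := hfsurj j
    refine ⟨i, ?_⟩
    have h1 := (centerGradeGroup 𝒜).sub_mem (hdeg hx _ hj) (hfdeg i)
    rwa [sub_sub_sub_cancel_right] at h1

variable [IsAddTorsionFree Γ]

/-- If `E` has an unramified maximal graded subfield `L` and a totally ramified one `K`, then
`E₀ ⊆ L` and all automorphisms of `E₀` are induced by elements of `K`.  As `K` is commutative, the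
commutator pairing is trivial. -/
theorem sk1_mulEquiv_of_unramified_of_totallyRamified {L K : Subring E}
    (hL : Maximal (IsGradedSubfield 𝒜) L) (hK : Maximal (IsGradedSubfield 𝒜) K)
    (hLT : gradeSet 𝒜 L = gradeSet 𝒜 (Subring.center E))
    (hK0 : ∀ x ∈ K, x ∈ 𝒜 0 → x ∈ Subring.center E) :
    ∃ (h : IsSemiramified 𝒜) (_ : Finite (GalZero 𝒜)), Nonempty (SK1 E ≃* TateZero 𝒜 h) := by
  obtain ⟨L', hL', hLL⟩ := exists_isSelfCentralizing_of_maximal hL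
  obtain ⟨K', hK', hKK⟩ := exists_isSelfCentralizing_of_maximal hK
  have hmemL : ∀ x, x ∈ L' ↔ x ∈ L := fun x => by
    rw [← SetLike.mem_coe, hLL, SetLike.mem_coe]
  have hmemK : ∀ x, x ∈ K' ↔ x ∈ K := fun x => by
    rw [← SetLike.mem_coe, hKK, SetLike.mem_coe]
  have hLT' : ∀ γ, ∀ a ∈ L', a ∈ 𝒜 γ → a ≠ 0 → γ ∈ centerGradeGroup 𝒜 := by
    intro γ a ha haγ h0
    have h1 : γ ∈ gradeSet 𝒜 L := ⟨a, (hmemL a).mp ha, haγ, h0⟩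
    rw [hLT] at h1
    exact h1
  obtain ⟨y, κ, hy, hyK, hκ⟩ := exists_units_of_totallyRamified hK'
    fun x hx hx0 => hK0 x ((hmemK x).mp hx) hx0
  obtain ⟨hE0, hdeg⟩ := zero_mem_and_degrees hL' hLT' hy hκ
  have hindex : (centerGradeGroup 𝒜).relIndex (gradeGroup 𝒜) = ind E := by
    let F : Fin (ind E) → GradeQuotient 𝒜 := fun i =>
      ((⟨κ i, unit_mem_gradeGroup (hy i)⟩ : gradeGroup 𝒜) : GradeQuotient 𝒜)
    have hF : Function.Bijective F := by
      constructor
      · intro i j hij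
        have h1 := QuotientAddGroup.eq.mp hij.symm
        rw [AddSubgroup.mem_addSubgroupOf] at h1
        refine hκ i j ?_
        rw [sub_eq_neg_add]
        exact h1
      · intro q
        obtain ⟨γ, rfl⟩ := QuotientAddGroup.mk_surjective q
        obtain ⟨i, hi⟩ := hdeg γ γ.2
        refine ⟨i, QuotientAddGroup.eq.mpr ?_⟩
        rw [AddSubgroup.mem_addSubgroupOf]
        rw [sub_eq_neg_add] at hi
        exact hi
    have h1 := Nat.card_eq_of_bijective F hF
    rw [Nat.card_fin] at h1
    exact h1.symm
  have h : IsSemiramified 𝒜 :=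
    { isField := by
        have : Nontrivial (ZeroPart 𝒜) :=
          IsGradedDivisionRing.toNontrivial (trivialGrading (ZeroPart 𝒜))
        refine ⟨exists_pair_ne _, fun a b => Subtype.ext
          (hL'.mul_comm (hE0 _ a.2) (hE0 _ b.2)), fun {a} ha => ?_⟩
        obtain ⟨u, rfl⟩ := isUnit_of_mem (𝒜 := trivialGrading (ZeroPart 𝒜))
          (γ := PUnit.unit) (a := a) trivial ha
        exact ⟨((u⁻¹ : (ZeroPart 𝒜)ˣ) : ZeroPart 𝒜), u.mul_inv⟩
      finrank_eq := finrank_zeroPart_of_unramified hL' hLT' hE0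
      index_eq := hindex }
  obtain ⟨hfin, hcomm, θ, α, β, -, hα, -, hexact, hβ⟩ := h.exact_sequence
  refine ⟨h, hfin, ⟨(MulEquiv.ofBijective β ⟨?_, hβ⟩).symm⟩⟩
  have hKact : ∀ σ : GalZero 𝒜, ∃ x : Eˣ, (x : E) ∈ K ∧ ConjActsAs 𝒜 x σ := by
    intro σ
    obtain ⟨x, rfl⟩ := h.conjAut_surjective_and_card.1 σ
    obtain ⟨γ, hγ⟩ := exists_degree_mem (𝒜 := 𝒜) x
    obtain ⟨i, hi⟩ := hdeg γ γ.2
    refine ⟨y i, (hmemK _).mp (hyK i), conjActsAs_iff.mpr ?_⟩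
    rw [← inv_mul_eq_one, ← map_inv, ← map_mul]
    apply h.conjAut_eq_one_of_degreeClass
    rw [map_mul, map_inv, degreeClass_apply hγ,
      degreeClass_apply (γ := ⟨κ i, unit_mem_gradeGroup (hy i)⟩) (hy i), inv_mul_eq_one]
    refine congrArg Multiplicative.ofAdd (QuotientAddGroup.eq.mpr ?_)
    rw [AddSubgroup.mem_addSubgroupOf]
    rw [sub_eq_neg_add] at hi
    exact hi
  have hα1 : ∀ z, α z = 1 := by
    refine wedge_hom_eq_one α fun σ τ => ?_
    obtain ⟨x, hxK, hx⟩ := hKact σ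
    obtain ⟨w, hwK, hw⟩ := hKact τ
    obtain ⟨c, hc, hcq⟩ := hα σ τ x w hx hw
    have hxw : x * w = w * x := Units.ext (hK.prop.comm _ hxK _ hwK)
    rw [hxw, mul_inv_cancel_right, mul_inv_cancel, Units.val_one] at hc
    have hc1 : c = 1 := Subtype.ext (Units.ext (Subtype.ext hc))
    rw [← hcq, hc1]
    rfl
  rw [← MonoidHom.ker_eq_bot_iff, ← hexact, MonoidHom.range_eq_bot_iff]
  exact MonoidHom.ext hα1

end Decomposed

end GrDiv

theorem mainTheorem5 {Γ : Type*} [AddCommGroup Γ] [IsAddTorsionFree Γ] [DecidableEq Γ]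
    {E : Type*} [Ring E] (𝒜 : Γ → AddSubgroup E) [GradedRing 𝒜] [GrDiv.IsGradedDivisionRing 𝒜]
    [Module.Finite (Subring.center E) E] :
    -- (i)
    (GrDiv.IsUnramified 𝒜 → Nonempty (GrDiv.SK1 E ≃* GrDiv.SK1 (GrDiv.ZeroPart 𝒜))) ∧
    -- (ii)
    (GrDiv.IsTotallyRamified 𝒜 →
      rootsOfUnity (AddMonoid.exponent (GrDiv.GradeQuotient 𝒜)) (GrDiv.CenterZero 𝒜) ≤
          rootsOfUnity (GrDiv.ind E) (GrDiv.CenterZero 𝒜) ∧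
        Nonempty (GrDiv.SK1 E ≃*
          rootsOfUnity (GrDiv.ind E) (GrDiv.CenterZero 𝒜) ⧸
            (rootsOfUnity (AddMonoid.exponent (GrDiv.GradeQuotient 𝒜))
              (GrDiv.CenterZero 𝒜)).subgroupOf
              (rootsOfUnity (GrDiv.ind E) (GrDiv.CenterZero 𝒜)))) ∧
    -- (iii)
    (∀ h : GrDiv.IsSemiramified 𝒜,
      ∃ (_ : Finite (GrDiv.GalZero 𝒜)) (_ : IsMulCommutative (GrDiv.GalZero 𝒜))
        (θ : GrDiv.GalZero 𝒜 ≃* Multiplicative (GrDiv.GradeQuotient 𝒜))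
        (α : Multiplicative (⋀[ℤ]^2 (Additive (GrDiv.GalZero 𝒜))) →* GrDiv.TateZero 𝒜 h)
        (β : GrDiv.TateZero 𝒜 h →* GrDiv.SK1 E),
        (∀ (γ : GrDiv.gradeGroup 𝒜) (x : Eˣ), (x : E) ∈ 𝒜 γ →
          GrDiv.ConjActsAs 𝒜 x (θ.symm (Multiplicative.ofAdd (γ : GrDiv.GradeQuotient 𝒜)))) ∧
        (∀ (σ τ : GrDiv.GalZero 𝒜) (x y : Eˣ),
          GrDiv.ConjActsAs 𝒜 x σ → GrDiv.ConjActsAs 𝒜 y τ →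
          GrDiv.TateZero.IsClassOf 𝒜
            (α (Multiplicative.ofAdd
              (exteriorPower.ιMulti ℤ 2 ![Additive.ofMul σ, Additive.ofMul τ])))
            ((x * y * x⁻¹ * y⁻¹ : Eˣ) : E)) ∧
        (∀ (q : GrDiv.TateZero 𝒜 h) (a : E),
          GrDiv.TateZero.IsClassOf 𝒜 q a → GrDiv.SK1.IsClassOf (β q) a) ∧
        α.range = β.ker ∧ Function.Surjective β) ∧
    -- (iv)
    ((∃ L K : Subring E,
        Maximal (GrDiv.IsGradedSubfield 𝒜) L ∧ Maximal (GrDiv.IsGradedSubfield 𝒜) K ∧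
        GrDiv.gradeSet 𝒜 L = GrDiv.gradeSet 𝒜 (Subring.center E) ∧
        (∀ x ∈ K, x ∈ 𝒜 0 → x ∈ Subring.center E)) →
      ∃ (h : GrDiv.IsSemiramified 𝒜) (_ : Finite (GrDiv.GalZero 𝒜)),
        Nonempty (GrDiv.SK1 E ≃* GrDiv.TateZero 𝒜 h)) :=
  ⟨fun h => GrDiv.IsUnramified.sk1_mulEquiv h, fun h => GrDiv.IsTotallyRamified.sk1_mulEquiv h,
    fun h => GrDiv.IsSemiramified.exact_sequence h, fun ⟨_, _, hL, hK, hLT, hK0⟩ =>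
      GrDiv.sk1_mulEquiv_of_unramified_of_totallyRamified hL hK hLT hK0⟩
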